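/- Let $n\ge 1$, $k\ge 0$, $\sigma_w,\sigma_b\ge 0$. Let $\phi:\mathbb R\to\mathbb R$ be continuous with $\mathbb E[\phi(Z)^2]<\infty$ for every centred real Gaussian $Z$. For each number of channels $c$ consider a one-dimensional convolutional network with periodic boundary conditions, spatial locations $\alpha\in\mathbb Z/n$ and pre-activations $$h^{l+1}_j(\alpha)=\sum_{i=1}^{c}\sum_{|\beta|\le k}\phi\big(h^l_i(\alpha+\beta)\big)\,\omega^{l+1}_{ij}(\beta)+b^{l+1}_j,\qquad 1\le j\le c,\ l\ge 0,$$ where all weights and biases are independent, $\omega^{l}_{ij}(\beta)\sim\mathcal N\big(0,\sigma_w^2/(c(2k+1))\big)$ and $b^l_j\sim\mathcal N(0,\sigma_b^2)$. For matrices indexed by $\mathbb Z/n$ put $$[\mathcal C(\Sigma)]_{\alpha,\alpha'}=\sigma_w^2\,\mathbb E_{h\sim\mathcal N(0,\Sigma)}[\phi(h_\alpha)\phi(h_{\alpha'})]+\sigma_b^2\ \ (\Sigma\text{ positive semidefinite}),\qquad [\mathcal A\star C]_{\alpha,\alpha'}=\frac1{2k+1}\sum_{|\beta|\le k}C_{\alpha+\beta,\alpha'+\beta}.$$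 Let the input $h^0=(h^0_j)_{1\le j\le c}$ be of one of the following two kinds. (A) For every $c$ the vectors $h^0_j$ are i.i.d. $\mathcal N(0,\Sigma^0)$ and independent of all weights and biases, with $\Sigma^0$ a fixed positive semidefinite matrix. (B) $h^0$ is deterministic (possibly different for each $c$) and $\frac1c\sum_{i=1}^c\phi(h^0_i(\alpha))\phi(h^0_i(\alpha'))\to M_{\alpha,\alpha'}$ as $c\to\infty$ for all $\alpha,\alpha'$. Then there are positive semidefinite matrices $\Sigma^{l+1}$, $l\ge 0$, such that for each $l\ge 0$, as $c\to\infty$, the vectors $h^{l+1}_j$ become i.i.d. $\mathcal N(0,\Sigma^{l+1})$: for every $m$, the joint law of any $m$ distinct channels (whose choice may depend on $c$) converges weakly to $\mathcal N(0,\Sigma^{l+1})^{\otimes m}$. If moreover $|\phi|$ is bounded by a polynomial in $|x|$, then at every width the $h^{l+1}_j(\alpha)$ are square integrable with mean zero, and $\mathbb E[h^{l+1}_j(\alpha)h^{l+1}_j(\alpha')]\to\Sigma^{l+1}_{\alpha,\alpha'}$ as $c\to\infty$, uniformly in $j\le c$. These matrices satisfy $$\Sigma^{l+1}=\mathcal A\star\mathcal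 C(\Sigma^l)$$ for every $l\ge 0$ in case (A), and for every $l\ge 1$ in case (B), where $\Sigma^1=\mathcal A\star\big(\sigma_w^2 M+\sigma_b^2\mathbf 1\mathbf 1^{\top}\big)$. -/

import Mathlib

open MeasureTheory ProbabilityTheory Filter
open scoped NNReal Topology

noncomputable section

/-- The kernel window `{β ∈ ℤ : |β| ≤ k}`, of size `2k+1`. -/
abbrev KernelWindow (k : ℕ) : Type := ↥(Finset.Icc (-(k : ℤ)) (k : ℤ))

/-- Pre-activations of a periodic one-dimensional convolutional network with `c` channels,
spatial locations `ZMod n` (periodic boundary) and activation `φ`. `preact φ W b h₀ l j α` is the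
pre-activation at layer `l`, channel `j`, location `α`; the layer-`0` pre-activations `h₀` are given.
`W l i j β` and `b l j` are the weights and biases that lead from layer `l` to layer `l + 1`. -/
def preact {n k c : ℕ} (φ : ℝ → ℝ) (W : ℕ → Fin c → Fin c → KernelWindow k → ℝ)
    (b : ℕ → Fin c → ℝ) (h₀ : Fin c → EuclideanSpace ℝ (ZMod n)) :
    ℕ → Fin c → EuclideanSpace ℝ (ZMod n)
  | 0 => h₀
  | l + 1 => fun j => WithLp.toLp 2 fun α =>
      (∑ i : Fin c, ∑ β : KernelWindow k,
        φ (preact φ W b h₀ l i (α + ((β : ℤ) : ZMod n))) * W l i j β) + b l j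

/-- All weights and biases of a random network with `c` channels, as one family of random
variables. -/
def cnnParams {k c : ℕ} {Ω : Type*} (W : ℕ → Fin c → Fin c → KernelWindow k → Ω → ℝ)
    (b : ℕ → Fin c → Ω → ℝ) :
    (ℕ × Fin c × Fin c × KernelWindow k) ⊕ (ℕ × Fin c) → Ω → ℝ :=
  Sum.elim (fun p => W p.1 p.2.1 p.2.2.1 p.2.2.2) (fun p => b p.1 p.2)

/-- Random Gaussian initialization: all weights and biases are mutually independent, the weights have
law `N(0, σ_w² / (c (2k+1)))` and the biases have law `N(0, σ_b²)`. -/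
structure IsGaussianInit {k c : ℕ} {Ω : Type*} [MeasurableSpace Ω] (σw σb : ℝ≥0) (P : Measure Ω)
    (W : ℕ → Fin c → Fin c → KernelWindow k → Ω → ℝ) (b : ℕ → Fin c → Ω → ℝ) : Prop where
  weight_law : ∀ l i j β,
    HasLaw (W l i j β) (gaussianReal 0 (σw ^ 2 / ((c : ℝ≥0) * (2 * (k : ℝ≥0) + 1)))) P
  bias_law : ∀ l j, HasLaw (b l j) (gaussianReal 0 (σb ^ 2)) P
  indep : iIndepFun (cnnParams W b) P

/-- Gaussian input: the input channels are i.i.d. `N(0, S)` vectors, independent of all weights and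
biases. -/
structure IsGaussianInput {n k c : ℕ} [NeZero n] {Ω : Type*} [MeasurableSpace Ω] (P : Measure Ω)
    (W : ℕ → Fin c → Fin c → KernelWindow k → Ω → ℝ) (b : ℕ → Fin c → Ω → ℝ)
    (S : Matrix (ZMod n) (ZMod n) ℝ) (h₀ : Fin c → Ω → EuclideanSpace ℝ (ZMod n)) : Prop where
  law : ∀ j, HasLaw (h₀ j) (multivariateGaussian 0 S) P
  indep : iIndepFun h₀ P
  indep_params : IndepFun (fun ω j => h₀ j ω) (fun ω p => cnnParams W b p ω) P

/-- The random pre-activation vector of channel `j` at layer `l`. -/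
def randomPreact {n k c : ℕ} {Ω : Type*} (φ : ℝ → ℝ)
    (W : ℕ → Fin c → Fin c → KernelWindow k → Ω → ℝ) (b : ℕ → Fin c → Ω → ℝ)
    (h₀ : Fin c → Ω → EuclideanSpace ℝ (ZMod n)) (l : ℕ) (j : Fin c) (ω : Ω) :
    EuclideanSpace ℝ (ZMod n) :=
  preact φ (fun l i j β => W l i j β ω) (fun l j => b l j ω) (fun j => h₀ j ω) l j

/-- The map `C(S)_{α,α'} = σ_w² 𝔼_{h ∼ N(0,S)} [φ(h_α) φ(h_α')] + σ_b²`. -/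
def cMap {n : ℕ} [NeZero n] (φ : ℝ → ℝ) (σw σb : ℝ≥0) (S : Matrix (ZMod n) (ZMod n) ℝ) :
    Matrix (ZMod n) (ZMod n) ℝ :=
  Matrix.of fun α α' =>
    (σw : ℝ) ^ 2 * (∫ h, φ (h α) * φ (h α') ∂(multivariateGaussian 0 S)) + (σb : ℝ) ^ 2

/-- The operator `A ⋆`: uniform averaging along the cyclic diagonals over the kernel window,
`[A ⋆ C]_{α,α'} = (2k+1)⁻¹ ∑_{|β| ≤ k} C_{α+β,α'+β}`. -/
def diagAverage {n : ℕ} (k : ℕ) (C : Matrix (ZMod n) (ZMod n) ℝ) :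
    Matrix (ZMod n) (ZMod n) ℝ :=
  Matrix.of fun α α' =>
    1 / (2 * (k : ℝ) + 1) *
      ∑ β : KernelWindow k, C (α + ((β : ℤ) : ZMod n)) (α' + ((β : ℤ) : ZMod n))

/-- In the limit of infinitely many channels the vectors `h c j`, `j : Fin c`, are i.i.d. `N(0, S)`:
along every sequence of widths tending to infinity, any `m` distinct channels converge jointly in
distribution to `m` independent `N(0, S)` vectors. -/
def ConvergesToIIDGaussian {n : ℕ} [NeZero n] {Ω : ℕ → Type*} [∀ c, MeasurableSpace (Ω c)]
    (P : ∀ c, Measure (Ω c)) [∀ c, IsProbabilityMeasure (P c)]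
    (h : ∀ c, Fin c → Ω c → EuclideanSpace ℝ (ZMod n)) (S : Matrix (ZMod n) (ZMod n) ℝ) : Prop :=
  S.PosSemidef ∧
    ∀ (m : ℕ) (w : ℕ → ℕ), Tendsto w atTop atTop → ∀ e : ∀ r, Fin m ↪ Fin (w r),
      TendstoInDistribution (fun (r : ℕ) (ω : Ω (w r)) (j : Fin m) => h (w r) (e r j) ω) atTop
        (id : (Fin m → EuclideanSpace ℝ (ZMod n)) → (Fin m → EuclideanSpace ℝ (ZMod n)))
        (fun r => P (w r)) (Measure.pi fun _ : Fin m => multivariateGaussian 0 S)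

/-- At every width the vectors `h c j` are square integrable with mean zero, and their covariance
matrices converge to `S` as `c → ∞`, uniformly over the channels. -/
def CovarianceConverges {n : ℕ} {Ω : ℕ → Type*} [∀ c, MeasurableSpace (Ω c)]
    (P : ∀ c, Measure (Ω c)) (h : ∀ c, Fin c → Ω c → EuclideanSpace ℝ (ZMod n))
    (S : Matrix (ZMod n) (ZMod n) ℝ) : Prop :=
  (∀ c j α, MemLp (fun ω => h c j ω α) 2 (P c) ∧ ∫ ω, h c j ω α ∂(P c) = 0) ∧
    ∀ α α', ∀ ε : ℝ, 0 < ε → ∀ᶠ c in atTop, ∀ j : Fin c,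
      |(∫ ω, h c j ω α * h c j ω α' ∂(P c)) - S α α'| < ε

/-- At most polynomial growth. -/
def PolynomiallyBounded (φ : ℝ → ℝ) : Prop :=
  ∃ (K : ℝ) (r : ℕ), ∀ x, |φ x| ≤ K * (1 + |x|) ^ r

end

/-!
Write `μ_l` for the joint law of the `c` channels at layer `l`. Given layer `l`, the channels of
layer `l + 1` are linear combinations of independent Gaussian weights and biases which are
independent of layer `l`. Hence they are conditionally i.i.d. `N(0, K)`, where the random matrix
`K = A ⋆ (σ_w² c⁻¹ ∑ᵢ φ(hᵢ) φ(hᵢ)ᵀ + σ_b²)`, called `condCov` below, depends on layer `l` only. So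
`μ_(l+1)` is a mixture over `μ_l` of i.i.d. Gaussian laws (`IsGaussianInit.isGaussianMixture`, from
`map_layerMap_layerLaw`, which computes a characteristic function).

Everything follows from the fact that `K` converges in probability to the constant `Σ^(l+1)`, which
is proved by induction on `l`. If `K` at layer `l` concentrates at `Σ`, then, by a law of large
numbers, `c⁻¹ ∑ᵢ φ(hᵢ) φ(hᵢ)ᵀ` at layer `l + 1` concentrates at the second moment of `φ` under
`N(0, Σ)` (`IsGaussianMixture.concentratesAt_average`). The law of large numbers has to be uniform
for covariances near `Σ` (`exists_nhds_integral_abs_average_sub_le`). For bounded continuous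
functions this follows from the variance of an average and from the continuity of `N(0, S)` in `S`,
through the continuity of the matrix square root. The unbounded `φ` is truncated: since the density
of `N(0, v)` at `x` increases with `v` as long as `v ≤ x²`, the tail of `φ²` under `N(0, v)`, for any
`v ≤ V`, is at most the tail under `N(0, V)` (`exists_integral_sq_sub_le`), so that square
integrability under each Gaussian suffices.

Convergence of finitely many channels in distribution is then the continuity of `N(0, S)^⊗m` in `S`,
integrated over the random `K` (`IsGaussianMixture.tendsto_integral_comp_embedding`). As to
covariances, `𝔼[h_j(α) h_j(α')] = 𝔼[K_{α,α'}]`, and the convergence of `K` in probability gives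
convergence of its mean because, for polynomially bounded `φ`, all moments of `K` are bounded
uniformly in the width (`IsGaussianMixture.hasBoundedMoments_average`).
-/

noncomputable section

/-! ### Gaussian measures: dependence on the covariance and tails -/

section Gaussian

open scoped MatrixOrder

variable {ι : Type*} [Fintype ι] [DecidableEq ι]

open scoped Matrix.Norms.L2Operator in
lemma continuousOn_matrix_sqrt :
    ContinuousOn (fun S : Matrix ι ι ℝ => CFC.sqrt S) {S | S.PosSemidef} := by
  have h := CFC.continuousOn_sqrt (A := Matrix ι ι ℝ)
  refine h.mono fun S hS => ?_
  exact Matrix.PosSemidef.nonneg hS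

/-- Independent `N(0, S)` vectors as the images of independent standard Gaussian vectors under the
square root of `S`. -/
lemma pi_multivariateGaussian_eq_map {κ : Type*} [Fintype κ] (S : Matrix ι ι ℝ) :
    Measure.pi (fun _ : κ => multivariateGaussian 0 S) =
      (Measure.pi fun _ : κ => stdGaussian (EuclideanSpace ℝ ι)).map
        (fun z j => Matrix.toEuclideanCLM (𝕜 := ℝ) (CFC.sqrt S) (z j)) := by
  rw [Measure.pi_map_pi (by fun_prop)]
  simp [multivariateGaussian]

/-- Weak continuity of products of centred Gaussian measures in the covariance matrix. -/
lemma continuousOn_integral_pi_multivariateGaussian {κ : Type*} [Fintype κ]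
    {f : (κ → EuclideanSpace ℝ ι) → ℝ} (hf : Continuous f) {B : ℝ} (hB : ∀ y, |f y| ≤ B) :
    ContinuousOn (fun S : Matrix ι ι ℝ =>
      ∫ y, f y ∂(Measure.pi fun _ : κ => multivariateGaussian 0 S)) {S | S.PosSemidef} := by
  have key : ∀ S : Matrix ι ι ℝ, ∫ y, f y ∂(Measure.pi fun _ : κ => multivariateGaussian 0 S) =
      ∫ z, f (fun j => Matrix.toEuclideanCLM (𝕜 := ℝ) (CFC.sqrt S) (z j))
        ∂(Measure.pi fun _ : κ => stdGaussian (EuclideanSpace ℝ ι)) := by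
    intro S
    rw [pi_multivariateGaussian_eq_map, integral_map _ (by fun_prop)]
    exact (Continuous.measurable (by fun_prop)).aemeasurable
  simp_rw [key]
  have : FirstCountableTopology (Matrix ι ι ℝ) :=
    inferInstanceAs (FirstCountableTopology (ι → ι → ℝ))
  refine continuousOn_of_dominated (bound := fun _ => B) ?_ ?_ (integrable_const _) ?_
  · intro S _
    exact Continuous.aestronglyMeasurable (by fun_prop)
  · intro S _
    exact Eventually.of_forall fun z => hB _
  · refine Eventually.of_forall fun z => ?_
    refine hf.comp_continuousOn (continuousOn_pi.2 fun j => ?_)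
    have : Continuous fun A : Matrix ι ι ℝ => Matrix.toEuclideanCLM (𝕜 := ℝ) A (z j) := by
      have : (fun A : Matrix ι ι ℝ => Matrix.toEuclideanCLM (𝕜 := ℝ) A (z j)) =
        fun A => WithLp.toLp 2 (A.mulVec (z j).ofLp) := by
        ext A i; simp
      rw [this]
      fun_prop
    exact this.comp_continuousOn continuousOn_matrix_sqrt

lemma continuousOn_integral_multivariateGaussian
    {f : EuclideanSpace ℝ ι → ℝ} (hf : Continuous f) {B : ℝ} (hB : ∀ y, |f y| ≤ B) :
    ContinuousOn (fun S : Matrix ι ι ℝ => ∫ y, f y ∂(multivariateGaussian 0 S))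
      {S | S.PosSemidef} := by
  have h := continuousOn_integral_pi_multivariateGaussian (κ := Unit)
    (f := fun y => f (y ())) (by fun_prop) (fun y => hB _)
  refine h.congr fun S _ => ?_
  exact ((measurePreserving_eval (fun _ : Unit => multivariateGaussian 0 S) ()).integral_comp'
    (f := MeasurableEquiv.funUnique Unit _) f).symm

end Gaussian

/-- On the range `v ≤ x²` the centred Gaussian density at `x` increases with the variance `v`. -/
lemma gaussianPDFReal_le_of_le {v V : ℝ≥0} {x : ℝ} (hv : v ≠ 0) (hvV : v ≤ V)
    (hx : (V : ℝ) ≤ x ^ 2) : gaussianPDFReal 0 v x ≤ gaussianPDFReal 0 V x := by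
  have hv0 : (0 : ℝ) < v := by positivity
  have hV0 : (0 : ℝ) < V := hv0.trans_le (by exact_mod_cast hvV)
  have hle : (v : ℝ) ≤ V := by exact_mod_cast hvV
  set u : ℝ := V / v with hu
  have hu1 : 1 ≤ u := by rw [hu, le_div_iff₀ hv0]; linarith
  have h1 : √u ≤ Real.exp ((u - 1) / 2) := by
    rw [Real.sqrt_le_left (Real.exp_pos _).le, ← Real.exp_nat_mul]
    have := Real.add_one_le_exp (u - 1)
    convert this using 2 <;> push_cast <;> ring
  have h2 : (u - 1) / 2 ≤ x ^ 2 / (2 * v) - x ^ 2 / (2 * V) := by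
    have : x ^ 2 / (2 * v) - x ^ 2 / (2 * V) = x ^ 2 / V * ((u - 1) / 2) := by
      rw [hu]; field_simp
    rw [this]
    have h3 : 1 ≤ x ^ 2 / V := by rw [le_div_iff₀ hV0]; linarith
    nlinarith
  have h3 : √u ≤ Real.exp (x ^ 2 / (2 * v) - x ^ 2 / (2 * V)) :=
    h1.trans (Real.exp_le_exp.2 h2)
  simp only [gaussianPDFReal, sub_zero]
  have hV : (V : ℝ) = u * v := by rw [hu]; field_simp
  have hs : √(2 * Real.pi * V) = √u * √(2 * Real.pi * v) := by
    rw [hV, ← Real.sqrt_mul (by positivity)]; ring_nf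
  have he : Real.exp (-x ^ 2 / (2 * V)) =
      Real.exp (x ^ 2 / (2 * v) - x ^ 2 / (2 * V)) * Real.exp (-x ^ 2 / (2 * v)) := by
    rw [← Real.exp_add]; ring_nf
  have hsu : 0 < √u := Real.sqrt_pos.2 (by linarith)
  rw [hs, he, mul_inv]
  have h4 : 1 ≤ (√u)⁻¹ * Real.exp (x ^ 2 / (2 * v) - x ^ 2 / (2 * V)) := by
    rw [inv_mul_eq_div, le_div_iff₀ hsu]; linarith
  have h5 : 0 ≤ (√(2 * Real.pi * v))⁻¹ * Real.exp (-x ^ 2 / (2 * v)) := by positivity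
  calc _ ≤ ((√u)⁻¹ * Real.exp (x ^ 2 / (2 * v) - x ^ 2 / (2 * V))) *
      ((√(2 * Real.pi * v))⁻¹ * Real.exp (-x ^ 2 / (2 * v))) := le_mul_of_one_le_left h5 h4
    _ = _ := by ring

/-- Integrals of functions supported in `{x | V ≤ x²}` increase with the variance up to `V`. The
value at `0` matters only for `v = 0`, when the Gaussian is a Dirac mass. -/
lemma lintegral_gaussianReal_mono {v V : ℝ≥0} (hvV : v ≤ V) {f : ℝ → ENNReal} (hf : Measurable f)
    (h0 : f 0 = 0) (hfV : ∀ x : ℝ, x ^ 2 < V → f x = 0) :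
    ∫⁻ x, f x ∂(gaussianReal 0 v) ≤ ∫⁻ x, f x ∂(gaussianReal 0 V) := by
  by_cases hv : v = 0
  · simp [hv, lintegral_dirac' _ hf, h0]
  have hV : V ≠ 0 := fun h => hv (le_antisymm (h ▸ hvV) bot_le)
  rw [gaussianReal_of_var_ne_zero _ hv, gaussianReal_of_var_ne_zero _ hV,
    lintegral_withDensity_eq_lintegral_mul _ (measurable_gaussianPDF _ _) hf,
    lintegral_withDensity_eq_lintegral_mul _ (measurable_gaussianPDF _ _) hf]
  refine lintegral_mono fun x => ?_
  rcases lt_or_ge (x ^ 2) V with h | h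
  · simp [hfV x h]
  · simp only [Pi.mul_apply]
    gcongr
    exact ENNReal.ofReal_le_ofReal (gaussianPDFReal_le_of_le hv hvV h)

/-- Uniform integrability of `φ²` under all centred Gaussians of variance at most `V`. -/
lemma exists_integral_sq_sub_le {φ : ℝ → ℝ} (hφ : Continuous φ)
    (hφ2 : ∀ v : ℝ≥0, MemLp φ 2 (gaussianReal 0 v)) (V : ℝ≥0) {ε : ℝ} (hε : 0 < ε) :
    ∃ Q : ℝ, 0 ≤ Q ∧ ∀ v ≤ V, ∫ x, max (φ x ^ 2 - Q) 0 ∂(gaussianReal 0 v) ≤ ε := by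
  have hint : ∫⁻ x, ENNReal.ofReal (φ x ^ 2) ∂(gaussianReal 0 V) ≠ ⊤ := by
    have := (hφ2 V).integrable_sq
    rw [← ofReal_integral_eq_lintegral_ofReal this (Eventually.of_forall fun x => sq_nonneg _)]
    exact ENNReal.ofReal_ne_top
  have hmeas : Measurable fun x => ENNReal.ofReal (φ x ^ 2) := by fun_prop
  let s : ℕ → Set ℝ := fun N => {x | (N : ℝ) < |x|}
  have hs : ∀ N, MeasurableSet (s N) := fun N => measurableSet_lt (by fun_prop) (by fun_prop)
  have htend : Tendsto (fun N => ∫⁻ x, (s N).indicator (fun x => ENNReal.ofReal (φ x ^ 2)) x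
      ∂(gaussianReal 0 V)) atTop (𝓝 (∫⁻ _, 0 ∂(gaussianReal 0 V))) := by
    refine tendsto_lintegral_of_dominated_convergence (fun x => ENNReal.ofReal (φ x ^ 2))
      (fun N => hmeas.indicator (hs N)) (fun N => Eventually.of_forall fun x => ?_) hint
      (Eventually.of_forall fun x => ?_)
    · exact Set.indicator_le_self _ _ x
    · refine tendsto_const_nhds.congr' ?_
      filter_upwards [eventually_ge_atTop ⌈|x|⌉₊] with N hN
      have : x ∉ s N := by
        simp only [s, Set.mem_ofPred_eq, not_lt]
        exact (Nat.le_ceil _).trans (by exact_mod_cast hN)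
      simp [this]
  rw [lintegral_zero] at htend
  have hev := htend.eventually (gt_mem_nhds (ENNReal.ofReal_pos.2 hε))
  obtain ⟨N, hN, hN1⟩ := (hev.and (eventually_ge_atTop ⌈(V : ℝ) + 1⌉₊)).exists
  have hNV : (V : ℝ) + 1 ≤ N := (Nat.le_ceil _).trans (by exact_mod_cast hN1)
  obtain ⟨Q, hQ⟩ := (isCompact_Icc (a := -(N : ℝ)) (b := N)).exists_bound_of_continuousOn
    (f := fun x => φ x ^ 2) (by fun_prop)
  have hQ0 : 0 ≤ Q := (norm_nonneg _).trans (hQ 0 (by simp))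
  -- `Q` bounds `φ²` on `[-N, N]`, so that `(φ² - Q)₊` lives on the tail `|x| > N`.
  refine ⟨Q, hQ0, fun v hv => ?_⟩
  have hle : ∀ x : ℝ, |x| ≤ N → φ x ^ 2 ≤ Q := fun x hx =>
    (le_abs_self _).trans (hQ x (abs_le.1 hx))
  have hVs : (V : ℝ) ≤ (N : ℝ) ^ 2 := by nlinarith [V.coe_nonneg]
  rw [integral_eq_lintegral_of_nonneg_ae (f := fun x => max (φ x ^ 2 - Q) 0)
    (Eventually.of_forall fun x => le_max_right _ _) (by fun_prop)]
  refine ENNReal.toReal_le_of_le_ofReal hε.le ?_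
  refine le_trans (lintegral_mono fun x => ?_) ((lintegral_gaussianReal_mono hv
    (hmeas.indicator (hs N)) ?_ ?_).trans hN.le)
  · by_cases hx : x ∈ s N
    · rw [Set.indicator_of_mem hx]
      exact ENNReal.ofReal_le_ofReal (max_le (by linarith) (sq_nonneg _))
    · have hx' : |x| ≤ N := not_lt.1 hx
      rw [Set.indicator_of_notMem hx, max_eq_right (by linarith [hle x hx'])]
      simp
  · have : (0 : ℝ) ∉ s N := by simp [s]
    simp [this]
  · intro x hx
    have : x ∉ s N := by
      simp only [s, Set.mem_ofPred_eq, not_lt]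
      exact abs_le_of_sq_le_sq (hx.le.trans hVs) (Nat.cast_nonneg N)
    simp [this]

/-! ### Laws of large numbers for activations of Gaussian vectors -/

section LawOfLargeNumbers

variable {X : Type*} [MeasurableSpace X] (μ : Measure X) [IsProbabilityMeasure μ] {c : ℕ}

lemma integrable_comp_eval_pi {f : X → ℝ} (hf : Integrable f μ) (i : Fin c) :
    Integrable (fun x : Fin c → X => f (x i)) (Measure.pi fun _ => μ) :=
  (measurePreserving_eval (fun _ : Fin c => μ) i).integrable_comp_of_integrable hf

lemma integral_comp_eval_pi {f : X → ℝ} (hf : AEStronglyMeasurable f μ) (i : Fin c) :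
    ∫ x, f (x i) ∂(Measure.pi fun _ : Fin c => μ) = ∫ x, f x ∂μ :=
  integral_comp_eval (μ := fun _ : Fin c => μ) hf

/-- Quantitative law of large numbers in `L¹` for bounded functions; `δ` is free so as to avoid
square roots. -/
lemma integral_abs_average_sub_le_of_bounded (hc : 0 < c) {T : X → ℝ} (hT : Measurable T) {Q : ℝ}
    (hQ : ∀ x, |T x| ≤ Q) {δ : ℝ} (hδ : 0 < δ) :
    ∫ x, |1 / (c : ℝ) * ∑ i, T (x i) - ∫ y, T y ∂μ| ∂(Measure.pi fun _ : Fin c => μ) ≤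
      δ + Q ^ 2 / (c * δ) := by
  have hc' : (0 : ℝ) < c := by exact_mod_cast hc
  have hT2 : MemLp T 2 μ := MemLp.of_bound hT.aestronglyMeasurable Q (Eventually.of_forall hQ)
  have hTi : Integrable T μ := hT2.integrable (by norm_num)
  set F : (Fin c → X) → ℝ := fun x => 1 / (c : ℝ) * ∑ i, T (x i) with hF
  have hFm : Measurable F := by fun_prop
  have hQ0 : 0 ≤ Q := by
    obtain ⟨x⟩ := μ.nonempty_of_neZero
    exact (abs_nonneg _).trans (hQ x)
  have hFb : ∀ x, |F x| ≤ Q := by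
    intro x
    rw [hF]; simp only
    rw [abs_mul, abs_of_nonneg (by positivity : (0 : ℝ) ≤ 1 / c), one_div_mul_eq_div,
      div_le_iff₀ hc']
    refine (Finset.abs_sum_le_sum_abs _ _).trans ((Finset.sum_le_sum fun i _ => hQ _).trans ?_)
    simp [mul_comm]
  have hF2 : MemLp F 2 (Measure.pi fun _ : Fin c => μ) :=
    MemLp.of_bound hFm.aestronglyMeasurable Q (Eventually.of_forall hFb)
  have hmean : ∫ x, F x ∂(Measure.pi fun _ : Fin c => μ) = ∫ y, T y ∂μ := by
    rw [hF, integral_const_mul, integral_finsetSum _ fun i _ => integrable_comp_eval_pi μ hTi i]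
    simp_rw [integral_comp_eval_pi μ hTi.aestronglyMeasurable]
    simp
    field_simp
  have hvar : Var[F; Measure.pi fun _ : Fin c => μ] ≤ Q ^ 2 / c := by
    have h1 : F = fun x => 1 / (c : ℝ) * (∑ i, fun x : Fin c → X => T (x i)) x := by
      ext x; simp [hF]
    rw [h1, variance_const_mul, variance_sum_pi (μ := fun _ : Fin c => μ) (X := fun _ => T)
      (fun _ => hT2)]
    have h2 : Var[T; μ] ≤ Q ^ 2 := by
      refine (variance_le_sq_of_bounded (a := -Q) (b := Q)
        (Eventually.of_forall fun x => abs_le.1 (hQ x)) hT.aemeasurable).trans ?_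
      ring_nf; rfl
    simp only [Finset.sum_const, Finset.card_univ, Fintype.card_fin, nsmul_eq_mul]
    have : (1 / (c : ℝ)) ^ 2 * (c * Var[T; μ]) = Var[T; μ] / c := by field_simp
    rw [this]
    gcongr
  set m := ∫ y, T y ∂μ with hm
  have hint : Integrable (fun x => (F x - m) ^ 2) (Measure.pi fun _ : Fin c => μ) :=
    (hF2.sub (memLp_const m)).integrable_sq
  calc ∫ x, |F x - m| ∂(Measure.pi fun _ : Fin c => μ)
      ≤ ∫ x, (δ + (F x - m) ^ 2 / δ) ∂(Measure.pi fun _ : Fin c => μ) := by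
        refine integral_mono (((hF2.integrable (by norm_num)).sub (integrable_const m)).abs)
          ((integrable_const δ).add (hint.div_const δ)) fun x => ?_
        simp only
        rw [← sq_abs (F x - m)]
        set y := |F x - m|
        have hy : 0 ≤ y := abs_nonneg _
        -- The bound `y ≤ δ + y² / δ` trades the `L¹` norm for the variance.
        have : y * δ ≤ δ * δ + y ^ 2 := by nlinarith [sq_nonneg (y - δ)]
        have h3 : y = y * δ / δ := by field_simp
        calc y = y * δ / δ := h3
          _ ≤ (δ * δ + y ^ 2) / δ := by gcongr
          _ = _ := by field_simp
    _ = δ + Var[F; Measure.pi fun _ : Fin c => μ] / δ := by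
        rw [integral_add (integrable_const δ) (hint.div_const δ), integral_div,
          variance_eq_integral hFm.aemeasurable, hmean]
        simp
    _ ≤ δ + Q ^ 2 / (c * δ) := by
        rw [← div_div]
        gcongr

/-- Quantitative law of large numbers in `L¹`, by comparison with a bounded function. -/
lemma integral_abs_average_sub_le (hc : 0 < c) {ψ T : X → ℝ} (hψ : Integrable ψ μ)
    (hT : Measurable T) {Q : ℝ} (hQ : ∀ x, |T x| ≤ Q) {δ : ℝ} (hδ : 0 < δ) :
    ∫ x, |1 / (c : ℝ) * ∑ i, ψ (x i) - ∫ y, ψ y ∂μ| ∂(Measure.pi fun _ : Fin c => μ) ≤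
      δ + Q ^ 2 / (c * δ) + 2 * ∫ x, |ψ x - T x| ∂μ := by
  have hc' : (0 : ℝ) < c := by exact_mod_cast hc
  have hTi : Integrable T μ :=
    .of_bound hT.aestronglyMeasurable Q (Eventually.of_forall hQ)
  have hd : Integrable (fun x => |ψ x - T x|) μ := (hψ.sub hTi).abs
  set π := Measure.pi fun _ : Fin c => μ with hπ
  have hTs : Integrable (fun x : Fin c → X => 1 / (c : ℝ) * ∑ i, T (x i) - ∫ y, T y ∂μ) π :=
    ((integrable_finsetSum _ fun i _ => integrable_comp_eval_pi μ hTi i).const_mul _).sub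
      (integrable_const _)
  have hψs : Integrable (fun x : Fin c → X => 1 / (c : ℝ) * ∑ i, ψ (x i) - ∫ y, ψ y ∂μ) π :=
    ((integrable_finsetSum _ fun i _ => integrable_comp_eval_pi μ hψ i).const_mul _).sub
      (integrable_const _)
  have hds : Integrable (fun x : Fin c → X => 1 / (c : ℝ) * ∑ i, |ψ (x i) - T (x i)|) π :=
    (integrable_finsetSum _ fun i _ =>
      integrable_comp_eval_pi μ (f := fun x => |ψ x - T x|) hd i).const_mul _
  have hdm : ∫ x, 1 / (c : ℝ) * ∑ i, |ψ (x i) - T (x i)| ∂π = ∫ x, |ψ x - T x| ∂μ := by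
    rw [integral_const_mul, integral_finsetSum _ fun i _ =>
      integrable_comp_eval_pi μ (f := fun x => |ψ x - T x|) hd i]
    have : ∀ i : Fin c, ∫ x : Fin c → X, |ψ (x i) - T (x i)| ∂π = ∫ x, |ψ x - T x| ∂μ :=
      fun i => integral_comp_eval_pi μ (f := fun x => |ψ x - T x|) hd.aestronglyMeasurable i
    rw [Finset.sum_congr rfl fun i _ => this i]
    simp
    field_simp
  have hmd : |∫ y, T y ∂μ - ∫ y, ψ y ∂μ| ≤ ∫ x, |ψ x - T x| ∂μ := by
    rw [← integral_sub hTi hψ]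
    refine (abs_integral_le_integral_abs).trans (le_of_eq ?_)
    simp_rw [abs_sub_comm]
  calc ∫ x, |1 / (c : ℝ) * ∑ i, ψ (x i) - ∫ y, ψ y ∂μ| ∂π
      ≤ ∫ x, (|1 / (c : ℝ) * ∑ i, T (x i) - ∫ y, T y ∂μ| +
          1 / (c : ℝ) * ∑ i, |ψ (x i) - T (x i)| + ∫ x, |ψ x - T x| ∂μ) ∂π := by
        refine integral_mono hψs.abs ((hTs.abs.add hds).add (integrable_const _)) fun x => ?_
        have h1 : 1 / (c : ℝ) * ∑ i, ψ (x i) - ∫ y, ψ y ∂μ =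
            (1 / (c : ℝ) * ∑ i, T (x i) - ∫ y, T y ∂μ) +
              1 / (c : ℝ) * ∑ i, (ψ (x i) - T (x i)) + (∫ y, T y ∂μ - ∫ y, ψ y ∂μ) := by
          rw [Finset.sum_sub_distrib]; ring
        simp only
        rw [h1]
        refine (abs_add_three _ _ _).trans ?_
        gcongr
        rw [abs_mul, abs_of_nonneg (by positivity : (0 : ℝ) ≤ 1 / c)]
        gcongr
        exact Finset.abs_sum_le_sum_abs _ _
    _ = ∫ x, |1 / (c : ℝ) * ∑ i, T (x i) - ∫ y, T y ∂μ| ∂π + 2 * ∫ x, |ψ x - T x| ∂μ := by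
        have h2 := integral_add (hTs.abs.add hds) (integrable_const (∫ x, |ψ x - T x| ∂μ))
        have h3 := integral_add hTs.abs hds
        simp only [Pi.add_apply] at h2 h3
        rw [h2, h3, hdm]
        simp
        ring
    _ ≤ _ := by
        gcongr
        exact integral_abs_average_sub_le_of_bounded μ hc hT hQ hδ

end LawOfLargeNumbers

section GaussianActivation

variable {ι : Type*} [Fintype ι] [DecidableEq ι] {φ : ℝ → ℝ}

lemma memLp_activation (hφ2 : ∀ v : ℝ≥0, MemLp φ 2 (gaussianReal 0 v)) {S : Matrix ι ι ℝ}
    (hS : S.PosSemidef) (a : ι) : MemLp (fun h => φ (h a)) 2 (multivariateGaussian 0 S) :=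
  (hφ2 _).comp_measurePreserving (measurePreserving_eval_multivariateGaussian (μ := 0) hS (i := a))

lemma integrable_mul_activation (hφ2 : ∀ v : ℝ≥0, MemLp φ 2 (gaussianReal 0 v)) {S : Matrix ι ι ℝ}
    (hS : S.PosSemidef) (a a' : ι) :
    Integrable (fun h => φ (h a) * φ (h a')) (multivariateGaussian 0 S) :=
  (memLp_activation hφ2 hS a).integrable_mul (memLp_activation hφ2 hS a')

/-- The truncation of `x` to `[-Q, Q]`. -/
def clip (Q x : ℝ) : ℝ := max (-Q) (min x Q)

lemma continuous_clip (Q : ℝ) : Continuous (clip Q) := by unfold clip; fun_prop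

lemma abs_clip_le {Q : ℝ} (hQ : 0 ≤ Q) (x : ℝ) : |clip Q x| ≤ Q :=
  abs_le.2 ⟨le_max_left _ _, max_le (by linarith) (min_le_right _ _)⟩

/-- The error of clipping a product is controlled by the truncation errors of the two squares, so
that only one-dimensional tails are needed. -/
lemma abs_mul_sub_clip_le {Q : ℝ} (x y : ℝ) :
    |x * y - clip Q (x * y)| ≤ max (x ^ 2 - Q) 0 + max (y ^ 2 - Q) 0 := by
  have h0 : 0 ≤ max (x ^ 2 - Q) 0 := le_max_right _ _
  have h1 : 0 ≤ max (y ^ 2 - Q) 0 := le_max_right _ _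
  have h2 : x ^ 2 - Q ≤ max (x ^ 2 - Q) 0 := le_max_left _ _
  have h3 : y ^ 2 - Q ≤ max (y ^ 2 - Q) 0 := le_max_left _ _
  have hm : |x * y| - Q ≤ max (x ^ 2 - Q) 0 + max (y ^ 2 - Q) 0 := by
    rw [abs_mul]
    have h4 := sq_abs x
    have h5 := sq_abs y
    rcases le_total |x| |y| with h | h
    · nlinarith [abs_nonneg x, abs_nonneg y]
    · nlinarith [abs_nonneg x, abs_nonneg y]
  have h6 := le_abs_self (x * y)
  have h7 := neg_abs_le (x * y)
  unfold clip
  rw [abs_le]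
  constructor <;> rcases le_total (x * y) Q with h | h <;>
    rcases le_total (-Q) (min (x * y) Q) with h' | h' <;>
    simp only [min_eq_left h, min_eq_right h] at h' ⊢ <;>
    simp only [max_eq_left h', max_eq_right h'] <;> linarith

lemma integral_abs_sub_clip_le (hφ : Continuous φ)
    (hφ2 : ∀ v : ℝ≥0, MemLp φ 2 (gaussianReal 0 v)) {V : ℝ≥0} {Q η : ℝ}
    (hQ : ∀ v ≤ V, ∫ x, max (φ x ^ 2 - Q) 0 ∂(gaussianReal 0 v) ≤ η) {S : Matrix ι ι ℝ}
    (hS : S.PosSemidef) {a a' : ι} (ha : S a a ≤ V) (ha' : S a' a' ≤ V) :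
    ∫ h, |φ (h a) * φ (h a') - clip Q (φ (h a) * φ (h a'))| ∂(multivariateGaussian 0 S) ≤
      2 * η := by
  have hi : ∀ b : ι, Integrable (fun h => max (φ (h b) ^ 2 - Q) 0) (multivariateGaussian 0 S) :=
    fun b => ((memLp_activation hφ2 hS b).integrable_sq.sub (integrable_const Q)).pos_part
  have hb : ∀ b : ι, S b b ≤ V →
      ∫ h, max (φ (h b) ^ 2 - Q) 0 ∂(multivariateGaussian 0 S) ≤ η := by
    intro b hb
    have hmp := measurePreserving_eval_multivariateGaussian (μ := 0) hS (i := b)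
    have := integral_map (μ := multivariateGaussian 0 S) (φ := fun h => h b)
      hmp.measurable.aemeasurable (f := fun x => max (φ x ^ 2 - Q) 0) (by fun_prop)
    rw [← this, hmp.map_eq]
    refine hQ _ ?_
    rwa [Real.toNNReal_le_iff_le_coe]
  have hψ := integrable_mul_activation hφ2 hS a a'
  calc _ ≤ ∫ h, (max (φ (h a) ^ 2 - Q) 0 + max (φ (h a') ^ 2 - Q) 0)
        ∂(multivariateGaussian 0 S) := by
        refine integral_mono_of_nonneg (Eventually.of_forall fun _ => abs_nonneg _)
          ((hi a).add (hi a')) (Eventually.of_forall fun h => ?_)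
        exact abs_mul_sub_clip_le _ _
    _ ≤ 2 * η := by
        rw [integral_add (hi a) (hi a')]
        linarith [hb a ha, hb a' ha']

/-- Law of large numbers for the empirical moments of the activations of i.i.d. `N(0, K)` vectors,
uniformly for positive semidefinite `K` near `S`. -/
lemma exists_nhds_integral_abs_average_sub_le (hφ : Continuous φ)
    (hφ2 : ∀ v : ℝ≥0, MemLp φ 2 (gaussianReal 0 v)) {S : Matrix ι ι ℝ} (hS : S.PosSemidef)
    (a a' : ι) {ε : ℝ} (hε : 0 < ε) :
    ∃ U ∈ 𝓝 S, ∃ c₀ : ℕ, ∀ c ≥ c₀, ∀ K ∈ U, K.PosSemidef →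
      Integrable (fun x : Fin c → EuclideanSpace ℝ ι =>
        |1 / (c : ℝ) * ∑ i, φ (x i a) * φ (x i a') -
          ∫ h, φ (h a) * φ (h a') ∂(multivariateGaussian 0 S)|)
          (Measure.pi fun _ => multivariateGaussian 0 K) ∧
      ∫ x, |1 / (c : ℝ) * ∑ i, φ (x i a) * φ (x i a') -
        ∫ h, φ (h a) * φ (h a') ∂(multivariateGaussian 0 S)|
        ∂(Measure.pi fun _ : Fin c => multivariateGaussian 0 K) ≤ ε := by
  -- The error is at most `11 η`: `2 η` from the bounded law of large numbers at covariance `K`, `4 η`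
  -- from clipping there, and `5 η` from the change of the mean between `K` and `S`.
  set η : ℝ := ε / 11 with hη
  have hη0 : 0 < η := by positivity
  set V : ℝ≥0 := (S a a).toNNReal + (S a' a').toNNReal + 1 with hV
  have hSa : S a a < V := by
    have := Real.le_coe_toNNReal (S a a)
    push_cast [hV]
    have := (S a' a').toNNReal.coe_nonneg
    linarith
  have hSa' : S a' a' < V := by
    have := Real.le_coe_toNNReal (S a' a')
    push_cast [hV]
    have := (S a a).toNNReal.coe_nonneg
    linarith
  obtain ⟨Q, hQ0, hQ⟩ := exists_integral_sq_sub_le hφ hφ2 V hη0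
  set ψ : EuclideanSpace ℝ ι → ℝ := fun h => φ (h a) * φ (h a') with hψ
  set T : EuclideanSpace ℝ ι → ℝ := fun h => clip Q (φ (h a) * φ (h a')) with hT
  have hTc : Continuous T := (continuous_clip Q).comp (by fun_prop)
  have hTQ : ∀ h, |T h| ≤ Q := fun h => abs_clip_le hQ0 _
  have hTi : ∀ K : Matrix ι ι ℝ, Integrable T (multivariateGaussian 0 K) := fun K =>
    .of_bound hTc.aestronglyMeasurable Q (Eventually.of_forall hTQ)
  have hcont := continuousOn_integral_multivariateGaussian hTc hTQ S hS
  have hd : ∀ K : Matrix ι ι ℝ, K.PosSemidef → K a a ≤ V → K a' a' ≤ V →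
      ∫ h, |ψ h - T h| ∂(multivariateGaussian 0 K) ≤ 2 * η := fun K hK h1 h2 =>
    integral_abs_sub_clip_le hφ hφ2 hQ hK h1 h2
  have hd' : ∀ K : Matrix ι ι ℝ, K.PosSemidef → K a a ≤ V → K a' a' ≤ V →
      |∫ h, ψ h ∂(multivariateGaussian 0 K) - ∫ h, T h ∂(multivariateGaussian 0 K)| ≤ 2 * η := by
    intro K hK h1 h2
    rw [← integral_sub (integrable_mul_activation hφ2 hK a a') (hTi K)]
    exact abs_integral_le_integral_abs.trans (hd K hK h1 h2)
  have hU1 : ∀ᶠ K in 𝓝 S, K.PosSemidef → |∫ h, T h ∂(multivariateGaussian 0 K) -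
      ∫ h, T h ∂(multivariateGaussian 0 S)| < η := by
    have := Metric.tendsto_nhds.1 hcont η hη0
    rw [eventually_nhdsWithin_iff] at this
    exact this
  have hent : ∀ b : ι, Continuous fun K : Matrix ι ι ℝ => K b b := fun b => by fun_prop
  have hU2 : ∀ᶠ K in 𝓝 S, K a a < (V : ℝ) := (hent a).continuousAt.eventually (gt_mem_nhds hSa)
  have hU3 : ∀ᶠ K in 𝓝 S, K a' a' < (V : ℝ) := (hent a').continuousAt.eventually (gt_mem_nhds hSa')
  refine ⟨_, hU1.and (hU2.and hU3), ⌈Q ^ 2 / (η * η)⌉₊ + 1, ?_⟩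
  rintro c hc K ⟨hK1, hK2, hK3⟩ hK
  have hc0 : 0 < c := by omega
  have hc' : (0 : ℝ) < c := by exact_mod_cast hc0
  have hcQ : Q ^ 2 / (c * η) ≤ η := by
    have h1 : Q ^ 2 / (η * η) ≤ c := (Nat.le_ceil _).trans (by exact_mod_cast (by omega))
    rw [div_le_iff₀ (by positivity)] at h1 ⊢
    linarith
  have hψi := integrable_mul_activation hφ2 hK a a'
  set m := ∫ h, ψ h ∂(multivariateGaussian 0 S) with hm
  set mK := ∫ h, ψ h ∂(multivariateGaussian 0 K) with hmK
  have hint : ∀ r : ℝ, Integrable (fun x : Fin c → EuclideanSpace ℝ ι =>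
      |1 / (c : ℝ) * ∑ i, ψ (x i) - r|) (Measure.pi fun _ => multivariateGaussian 0 K) := fun r =>
    (((integrable_finsetSum _ fun i _ => integrable_comp_eval_pi _ hψi i).const_mul _).sub
      (integrable_const _)).abs
  refine ⟨hint m, ?_⟩
  have hmm : |mK - m| ≤ 5 * η := by
    have h1 := hd' K hK hK2.le hK3.le
    have h2 := hd' S hS hSa.le hSa'.le
    have h3 := hK1 hK
    rw [abs_le] at h1 h2 ⊢
    rw [abs_lt] at h3
    constructor <;> linarith [h1.1, h1.2, h2.1, h2.2, h3.1, h3.2]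
  calc ∫ x, |1 / (c : ℝ) * ∑ i, ψ (x i) - m| ∂(Measure.pi fun _ : Fin c => multivariateGaussian 0 K)
      ≤ ∫ x, (|1 / (c : ℝ) * ∑ i, ψ (x i) - mK| + |mK - m|)
          ∂(Measure.pi fun _ : Fin c => multivariateGaussian 0 K) :=
        integral_mono (hint m) ((hint mK).add (integrable_const _)) fun x => abs_sub_le _ _ _
    _ = ∫ x, |1 / (c : ℝ) * ∑ i, ψ (x i) - mK|
          ∂(Measure.pi fun _ : Fin c => multivariateGaussian 0 K) + |mK - m| := by
        rw [integral_add (hint mK) (integrable_const _)]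
        simp
    _ ≤ (η + Q ^ 2 / (c * η) + 2 * ∫ x, |ψ x - T x| ∂(multivariateGaussian 0 K)) + 5 * η := by
        gcongr
        exact integral_abs_average_sub_le _ hc0 hψi hTc.measurable hTQ hη0
    _ ≤ (η + η + 2 * (2 * η)) + 5 * η := by
        gcongr
        exact hd K hK hK2.le hK3.le
    _ = ε := by rw [hη]; ring

end GaussianActivation

/-! ### Convergence in probability to a constant and Gaussian mixtures -/

/-- Random elements `Y c` of a fixed space `F`, defined on varying probability spaces
`(X c, ν c)`, converge in probability to the constant `a`. -/
def ConcentratesAt {X : ℕ → Type*} [∀ c, MeasurableSpace (X c)] {F : Type*} [TopologicalSpace F]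
    (ν : ∀ c, Measure (X c)) (Y : ∀ c, X c → F) (a : F) : Prop :=
  ∀ U ∈ 𝓝 a, Tendsto (fun c => ν c {x | Y c x ∉ U}) atTop (𝓝 0)

namespace ConcentratesAt

variable {X : ℕ → Type*} [∀ c, MeasurableSpace (X c)] {ν : ∀ c, Measure (X c)}
  {F G : Type*} [TopologicalSpace F] [TopologicalSpace G]

lemma comp {Y : ∀ c, X c → F} {a : F} (h : ConcentratesAt ν Y a) {g : F → G}
    (hg : ContinuousAt g a) : ConcentratesAt ν (fun c x => g (Y c x)) (g a) :=
  fun U hU => h (g ⁻¹' U) (hg hU)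

lemma pi {κ : Type*} [Finite κ] {F : κ → Type*} [∀ i, TopologicalSpace (F i)]
    {Y : ∀ c, X c → ∀ i, F i} {a : ∀ i, F i}
    (h : ∀ i, ConcentratesAt ν (fun c x => Y c x i) (a i)) : ConcentratesAt ν Y a := by
  have := Fintype.ofFinite κ
  intro U hU
  rw [nhds_pi, Filter.mem_pi] at hU
  obtain ⟨I, -, t, ht, htU⟩ := hU
  have h0 : Tendsto (fun c => ∑ i, ν c {x | Y c x i ∉ t i}) atTop (𝓝 0) := by
    have := tendsto_finsetSum (Finset.univ : Finset κ) fun i _ => h i (t i) (ht i)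
    simpa using this
  refine tendsto_of_tendsto_of_tendsto_of_le_of_le tendsto_const_nhds h0 (fun _ => zero_le)
    fun c => ?_
  refine (measure_mono (t := ⋃ i ∈ (Finset.univ : Finset κ), {x | Y c x i ∉ t i})
    fun x hx => ?_).trans (measure_biUnion_finset_le _ _)
  by_contra hcon
  simp only [Set.mem_iUnion, not_exists, Set.mem_ofPred_eq, Finset.mem_univ, not_not,
    exists_prop, true_and] at hcon
  exact hx (htU fun i _ => hcon i)

lemma of_tendsto {y : ℕ → F} {a : F} (h : Tendsto y atTop (𝓝 a)) :
    ConcentratesAt ν (fun c _ => y c) a := by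
  intro U hU
  refine tendsto_const_nhds.congr' ?_
  filter_upwards [h hU] with c hc
  have : y c ∈ U := hc
  simp [this]

/-- Convergence in probability and a uniform `L²` bound give convergence of the means. -/
lemma tendsto_integral [∀ c, IsProbabilityMeasure (ν c)] {Y : ∀ c, X c → ℝ} {a : ℝ}
    (h : ConcentratesAt ν Y a) (hm : ∀ c, Measurable (Y c)) {B : ℝ≥0}
    (hB : ∀ c, eLpNorm (Y c) 2 (ν c) ≤ B) : Tendsto (fun c => ∫ x, Y c x ∂(ν c)) atTop (𝓝 a) := by
  have hL : ∀ c, MemLp (Y c) 2 (ν c) := fun c =>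
    ⟨(hm c).aestronglyMeasurable, (hB c).trans_lt ENNReal.coe_lt_top⟩
  have hLa : ∀ c, MemLp (fun x => Y c x - a) 2 (ν c) := fun c => (hL c).sub (memLp_const a)
  set D : ℝ := 2 * (B : ℝ) ^ 2 + 2 * a ^ 2 with hD
  have hsq : ∀ c, ∫ x, (Y c x - a) ^ 2 ∂(ν c) ≤ D := by
    intro c
    have h1 : ∫ x, (Y c x) ^ 2 ∂(ν c) ≤ (B : ℝ) ^ 2 := by
      have h2 := (hL c).eLpNorm_eq_integral_rpow_norm (by norm_num) (by norm_num)
      have h3 := hB c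
      rw [h2, ENNReal.ofReal_le_iff_le_toReal (by simp)] at h3
      simp only [ENNReal.toReal_ofNat, Real.rpow_ofNat, Real.norm_eq_abs, sq_abs,
        ENNReal.coe_toReal] at h3
      have h0 : 0 ≤ ∫ x, (Y c x) ^ 2 ∂(ν c) := integral_nonneg fun x => sq_nonneg _
      calc _ = ((∫ x, (Y c x) ^ 2 ∂(ν c)) ^ ((2 : ℝ)⁻¹)) ^ 2 := by
            rw [← Real.rpow_natCast, ← Real.rpow_mul h0]; norm_num
        _ ≤ _ := by gcongr
    have h4 : ∫ x, (Y c x - a) ^ 2 ∂(ν c) ≤ ∫ x, (2 * (Y c x) ^ 2 + 2 * a ^ 2) ∂(ν c) := by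
      refine integral_mono (hLa c).integrable_sq
        (((hL c).integrable_sq.const_mul 2).add (integrable_const _)) fun x => ?_
      simp only
      nlinarith [sq_nonneg (Y c x + a)]
    rw [integral_add ((hL c).integrable_sq.const_mul 2) (integrable_const _),
      integral_const_mul] at h4
    simp at h4
    linarith
  have hD0 : 0 ≤ D := by positivity
  rw [Metric.tendsto_nhds]
  intro ε hε
  -- The deviation is at most `ε / 4` off the exceptional set `A`, and at most
  -- `δ |Y - a|² + 1 / (4 δ)` on it. The choice of `δ` makes the quadratic term contribute at most
  -- `ε / 4`, and the measure of `A` is eventually small compared with `δ`.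
  set δ : ℝ := ε / (4 * (D + 1)) with hδ
  have hδ0 : 0 < δ := by positivity
  have hev := (h (Metric.ball a (ε / 4)) (Metric.ball_mem_nhds a (by positivity))).eventually
    (gt_mem_nhds (ENNReal.ofReal_pos.2 (by positivity : 0 < ε * (4 * δ) / 4)))
  filter_upwards [hev] with c hc
  set A : Set (X c) := {x | Y c x ∉ Metric.ball a (ε / 4)} with hA
  have hAm : MeasurableSet A := (hm c Metric.isOpen_ball.measurableSet).compl
  have hA1 : (ν c).real A ≤ ε * (4 * δ) / 4 := ENNReal.toReal_le_of_le_ofReal (by positivity) hc.le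
  have hint : Integrable (fun x => ε / 4 + δ * (Y c x - a) ^ 2 +
      1 / (4 * δ) * A.indicator (fun _ => (1 : ℝ)) x) (ν c) :=
    ((integrable_const _).add ((hLa c).integrable_sq.const_mul δ)).add
      (((integrable_const _).indicator hAm).const_mul _)
  have hadd : ∀ f g : X c → ℝ, Integrable f (ν c) → Integrable g (ν c) →
      ∫ x, (f x + g x) ∂(ν c) = ∫ x, f x ∂(ν c) + ∫ x, g x ∂(ν c) :=
    fun f g hf hg => integral_add hf hg
  have hYi : Integrable (Y c) (ν c) := (hL c).integrable (by norm_num)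
  calc dist (∫ x, Y c x ∂(ν c)) a = |∫ x, (Y c x - a) ∂(ν c)| := by
        rw [Real.dist_eq, integral_sub hYi (integrable_const _)]; simp
    _ ≤ ∫ x, |Y c x - a| ∂(ν c) := abs_integral_le_integral_abs
    _ ≤ ∫ x, (ε / 4 + δ * (Y c x - a) ^ 2 +
          1 / (4 * δ) * A.indicator (fun _ => (1 : ℝ)) x) ∂(ν c) := by
        refine integral_mono ((hLa c).integrable (by norm_num)).abs hint fun x => ?_
        simp only
        by_cases hx : x ∈ A
        · rw [Set.indicator_of_mem hx]
          rw [← sq_abs]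
          set y := |Y c x - a|
          have : 1 / (4 * δ) * 1 = 1 / (4 * δ) := mul_one _
          have h5 : y = (4 * δ * y) / (4 * δ) := by field_simp
          have h6 : (4 * δ * y) / (4 * δ) ≤ ((2 * δ * y) ^ 2 + 1) / (4 * δ) := by
            gcongr; nlinarith [sq_nonneg (2 * δ * y - 1)]
          have h7 : ((2 * δ * y) ^ 2 + 1) / (4 * δ) = δ * y ^ 2 + 1 / (4 * δ) * 1 := by
            field_simp; ring
          linarith
        · rw [Set.indicator_of_notMem hx]
          have : |Y c x - a| < ε / 4 := by
            simpa [hA, Real.dist_eq] using hx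
          have := mul_nonneg hδ0.le (sq_nonneg (Y c x - a))
          linarith
    _ = ε / 4 + δ * ∫ x, (Y c x - a) ^ 2 ∂(ν c) + 1 / (4 * δ) * (ν c).real A := by
        rw [hadd (fun x => ε / 4 + δ * (Y c x - a) ^ 2) _
          ((integrable_const _).add ((hLa c).integrable_sq.const_mul δ))
          (((integrable_const _).indicator hAm).const_mul _),
          hadd _ (fun x => δ * (Y c x - a) ^ 2) (integrable_const _)
            ((hLa c).integrable_sq.const_mul δ),
          integral_const_mul, integral_const_mul, integral_indicator_const _ hAm]
        simp
    _ ≤ ε / 4 + ε / (4 * (D + 1)) * D + 1 / (4 * δ) * (ε * (4 * δ) / 4) := by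
        gcongr
        exact hsq c
    _ < ε := by
        have h8 : 1 / (4 * δ) * (ε * (4 * δ) / 4) = ε / 4 := by field_simp
        have h9 : ε / (4 * (D + 1)) * D ≤ ε / 4 := by
          rw [div_mul_eq_mul_div, div_le_div_iff₀ (by positivity) (by norm_num)]
          nlinarith
        rw [h8]
        linarith

/-- Expectations of bounded functions, continuous at the limit within a set that supports all the
random elements. -/
lemma tendsto_integral_of_bounded [∀ c, IsProbabilityMeasure (ν c)] {Y : ∀ c, X c → F} {a : F}
    (h : ConcentratesAt ν Y a) {s : Set F} (hs : ∀ c x, Y c x ∈ s) {g : F → ℝ}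
    (hg : ContinuousWithinAt g s a) {B : ℝ} (hB : ∀ y, |g y| ≤ B)
    (hm : ∀ c, Measurable fun x => g (Y c x)) :
    Tendsto (fun c => ∫ x, g (Y c x) ∂(ν c)) atTop (𝓝 (g a)) := by
  have hB0 : 0 ≤ B := (abs_nonneg _).trans (hB a)
  refine tendsto_integral (B := B.toNNReal) ?_ hm fun c => ?_
  · intro U hU
    have h1 := hg hU
    rw [mem_map, mem_nhdsWithin_iff_exists_mem_nhds_inter] at h1
    obtain ⟨u, hu, hus⟩ := h1
    refine tendsto_of_tendsto_of_tendsto_of_le_of_le tendsto_const_nhds (h u hu)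
      (fun _ => zero_le) fun c => measure_mono fun x hx hxu => hx (hus ⟨hxu, hs c x⟩)
  · refine (eLpNorm_le_of_ae_bound (C := B) (Eventually.of_forall fun x => hB _)).trans ?_
    simp [ENNReal.ofReal]

end ConcentratesAt

/-- The law `μ` of `c` vectors is a mixture of i.i.d. centred Gaussian laws, the common covariance
matrix `L x` being drawn at random by picking `x` with law `ν`. -/
structure IsGaussianMixture {ι : Type*} [Fintype ι] [DecidableEq ι] {c : ℕ} {X : Type*}
    [MeasurableSpace X] (μ : Measure (Fin c → EuclideanSpace ℝ ι)) (ν : Measure X)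
    (L : X → Matrix ι ι ℝ) : Prop where
  posSemidef : ∀ x, (L x).PosSemidef
  measurable_entry : ∀ a a', Measurable fun x => L x a a'
  measurable_pi : Measurable fun x => Measure.pi fun _ : Fin c => multivariateGaussian 0 (L x)
  eq_bind : μ = ν.bind fun x => Measure.pi fun _ : Fin c => multivariateGaussian 0 (L x)

section Mixture

variable {ι : Type*} [Fintype ι] [DecidableEq ι]

lemma map_comp_embedding_pi {c m : ℕ} (e : Fin m ↪ Fin c) {E : Type*} [MeasurableSpace E]
    (μ : Measure E) [IsProbabilityMeasure μ] :
    (Measure.pi fun _ : Fin c => μ).map (fun y j => y (e j)) = Measure.pi fun _ : Fin m => μ := by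
  have h := iIndepFun_pi (μ := fun _ : Fin c => μ) (X := fun _ => id) (fun _ => aemeasurable_id)
  simp only [id] at h
  have h2 := h.precomp e.injective
  refine ((iIndepFun_iff_map_fun_eq_pi_map (f := fun (j : Fin m) (y : Fin c → E) => y (e j))
    fun i => (measurable_pi_apply (e i)).aemeasurable).1 h2).trans ?_
  congr 1
  ext1 j
  exact (measurePreserving_eval (fun _ : Fin c => μ) (e j)).map_eq

namespace IsGaussianMixture

section

variable {c : ℕ} {X : Type*} [MeasurableSpace X] {μ : Measure (Fin c → EuclideanSpace ℝ ι)}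
  {ν : Measure X} {L : X → Matrix ι ι ℝ} (h : IsGaussianMixture μ ν L)
include h

lemma lintegral_eq {f : (Fin c → EuclideanSpace ℝ ι) → ENNReal} (hf : Measurable f) :
    ∫⁻ y, f y ∂μ =
      ∫⁻ x, ∫⁻ y, f y ∂(Measure.pi fun _ : Fin c => multivariateGaussian 0 (L x)) ∂ν := by
  rw [h.eq_bind, Measure.lintegral_bind h.measurable_pi.aemeasurable hf.aemeasurable]

lemma isProbabilityMeasure [IsProbabilityMeasure ν] : IsProbabilityMeasure μ := by
  constructor
  rw [← lintegral_one, h.lintegral_eq measurable_const]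
  simp

lemma integral_eq [IsProbabilityMeasure ν] {f : (Fin c → EuclideanSpace ℝ ι) → ℝ}
    (hf : Integrable f μ) :
    ∫ y, f y ∂μ =
      ∫ x, ∫ y, f y ∂(Measure.pi fun _ : Fin c => multivariateGaussian 0 (L x)) ∂ν := by
  let κ : Kernel X (Fin c → EuclideanSpace ℝ ι) := ⟨_, h.measurable_pi⟩
  have hμ : μ = κ ∘ₘ ν := h.eq_bind
  rw [hμ, Measure.comp_eq_comp_const_apply] at hf ⊢
  rw [Kernel.integral_comp hf]
  simp [κ]

lemma measurable_integral {f : (Fin c → EuclideanSpace ℝ ι) → ℝ} (hf : Measurable f) :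
    Measurable fun x => ∫ y, f y ∂(Measure.pi fun _ : Fin c => multivariateGaussian 0 (L x)) := by
  let κ : Kernel X (Fin c → EuclideanSpace ℝ ι) := ⟨_, h.measurable_pi⟩
  have : IsMarkovKernel κ := ⟨fun x => by
    change IsProbabilityMeasure (Measure.pi fun _ : Fin c => multivariateGaussian 0 (L x))
    infer_instance⟩
  exact (hf.stronglyMeasurable.integral_kernel (κ := κ)).measurable

end

variable {X : ℕ → Type*} [∀ c, MeasurableSpace (X c)]
  {μ : ∀ c, Measure (Fin c → EuclideanSpace ℝ ι)} {ν : ∀ c, Measure (X c)}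
  [∀ c, IsProbabilityMeasure (ν c)] {L : ∀ c, X c → Matrix ι ι ℝ} {S : Matrix ι ι ℝ}
  (h : ∀ c, IsGaussianMixture (μ c) (ν c) (L c))
include h

/-- If the random covariance matrices concentrate, then any fixed number of channels become
independent Gaussian vectors. -/
lemma tendsto_integral_comp_embedding (hL : ConcentratesAt ν L S) (hS : S.PosSemidef) {m : ℕ}
    {f : (Fin m → EuclideanSpace ℝ ι) → ℝ} (hf : Continuous f) {B : ℝ} (hB : ∀ y, |f y| ≤ B)
    {w : ℕ → ℕ} (hw : Tendsto w atTop atTop) (e : ∀ r, Fin m ↪ Fin (w r)) :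
    Tendsto (fun r => ∫ y, f (fun j => y (e r j)) ∂(μ (w r))) atTop
      (𝓝 (∫ y, f y ∂(Measure.pi fun _ : Fin m => multivariateGaussian 0 S))) := by
  have := fun c => (h c).isProbabilityMeasure
  set G : Matrix ι ι ℝ → ℝ := fun K =>
    ∫ y, f y ∂(Measure.pi fun _ : Fin m => multivariateGaussian 0 K) with hG
  have hpi : ∀ r K, ∫ y, f (fun j => y (e r j))
      ∂(Measure.pi fun _ : Fin (w r) => multivariateGaussian 0 K) = G K := by
    intro r K
    simp only [hG]
    rw [← map_comp_embedding_pi (e r), integral_map _ (by fun_prop)]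
    exact (measurable_pi_lambda _ fun j => measurable_pi_apply (e r j)).aemeasurable
  have hfe : ∀ r, Continuous fun y : Fin (w r) → EuclideanSpace ℝ ι => f (fun j => y (e r j)) :=
    fun r => hf.comp (by fun_prop)
  have hGm : ∀ r, Measurable fun x => G (L (w r) x) := by
    intro r
    have := (h (w r)).measurable_integral (hfe r).measurable
    simpa only [hpi] using this
  have hGB : ∀ K, |G K| ≤ B := by
    intro K
    have := norm_integral_le_of_norm_le_const (μ := Measure.pi fun _ : Fin m =>
      multivariateGaussian 0 K) (C := B) (f := f) (Eventually.of_forall hB)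
    simpa using this
  have hLw : ConcentratesAt (fun r => ν (w r)) (fun r => L (w r)) S := fun U hU => (hL U hU).comp hw
  have := hLw.tendsto_integral_of_bounded (s := {K | K.PosSemidef})
    (fun r x => (h (w r)).posSemidef x)
    (continuousOn_integral_pi_multivariateGaussian hf hB S hS) hGB hGm
  refine this.congr fun r => ?_
  rw [(h (w r)).integral_eq]
  · simp_rw [hpi]; rfl
  · exact .of_bound (hfe r).aestronglyMeasurable B (Eventually.of_forall fun y => hB _)

/-- If the random covariance matrices concentrate, then so do the empirical second moments of the
activations. -/
lemma concentratesAt_average {φ : ℝ → ℝ} (hφ : Continuous φ)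
    (hφ2 : ∀ v : ℝ≥0, MemLp φ 2 (gaussianReal 0 v)) (hL : ConcentratesAt ν L S)
    (hS : S.PosSemidef) (a a' : ι) :
    ConcentratesAt μ (fun c y => 1 / (c : ℝ) * ∑ i, φ (y i a) * φ (y i a'))
      (∫ h, φ (h a) * φ (h a') ∂(multivariateGaussian 0 S)) := by
  intro U hU
  obtain ⟨ε, hε, hεU⟩ := Metric.mem_nhds_iff.1 hU
  rw [ENNReal.tendsto_nhds_zero]
  intro δ hδ
  set m := ∫ h, φ (h a) * φ (h a') ∂(multivariateGaussian 0 S) with hm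
  obtain ⟨d, hd0, hdδ⟩ : ∃ d : ℝ, 0 < d ∧ ENNReal.ofReal d ≤ δ / 2 := by
    obtain ⟨d, hd0, hd⟩ := ENNReal.lt_iff_exists_nnreal_btwn.1 (ENNReal.half_pos hδ.ne')
    exact ⟨d, by exact_mod_cast hd0, by simpa using hd.le⟩
  obtain ⟨V, hV, c₀, hc₀⟩ := exists_nhds_integral_abs_average_sub_le hφ hφ2 hS a a'
    (ε := ε * d) (by positivity)
  have hev := (hL V hV).eventually (gt_mem_nhds (ENNReal.half_pos hδ.ne'))
  filter_upwards [hev, eventually_ge_atTop c₀] with c hcV hc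
  set F : (Fin c → EuclideanSpace ℝ ι) → ℝ :=
    fun y => |1 / (c : ℝ) * ∑ i, φ (y i a) * φ (y i a') - m| with hF
  have hFm : Measurable F := Continuous.measurable (by fun_prop)
  set A : Set (Fin c → EuclideanSpace ℝ ι) := {y | ε ≤ F y} with hA
  have hAm : MeasurableSet A := measurableSet_le measurable_const hFm
  have hsub : {y : Fin c → EuclideanSpace ℝ ι |
      1 / (c : ℝ) * ∑ i, φ (y i a) * φ (y i a') ∉ U} ⊆ A := by
    intro y hy
    by_contra hcon
    refine hy (hεU ?_)
    rw [Metric.mem_ball, Real.dist_eq]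
    exact not_le.1 hcon
  have hbound : ∀ x, L c x ∈ V →
      (Measure.pi fun _ : Fin c => multivariateGaussian 0 (L c x)) A ≤ δ / 2 := by
    intro x hx
    obtain ⟨hi, hle⟩ := hc₀ c hc (L c x) hx ((h c).posSemidef x)
    have h1 := mul_meas_ge_le_integral_of_nonneg (Eventually.of_forall fun y => abs_nonneg _) hi ε
    have h2 : ε * (Measure.pi fun _ : Fin c => multivariateGaussian 0 (L c x)).real A ≤ ε * d :=
      h1.trans hle
    have h3 := le_of_mul_le_mul_left h2 hε
    refine le_trans ?_ hdδ
    rw [ENNReal.le_ofReal_iff_toReal_le (measure_ne_top _ _) hd0.le]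
    exact h3
  calc μ c _ ≤ μ c A := measure_mono hsub
    _ = ∫⁻ x, (Measure.pi fun _ : Fin c => multivariateGaussian 0 (L c x)) A ∂(ν c) := by
        rw [(h c).eq_bind, Measure.bind_apply hAm (h c).measurable_pi.aemeasurable]
    _ ≤ ∫⁻ x, ({x | L c x ∉ V}.indicator (fun _ => (1 : ENNReal)) x + δ / 2) ∂(ν c) := by
        refine lintegral_mono fun x => ?_
        by_cases hx : L c x ∈ V
        · exact (hbound x hx).trans le_add_self
        · have : x ∈ {x | L c x ∉ V} := hx
          rw [Set.indicator_of_mem this]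
          exact prob_le_one.trans le_self_add
    _ ≤ ν c {x | L c x ∉ V} + δ / 2 := by
        rw [lintegral_add_right _ measurable_const]
        gcongr
        · exact (lintegral_indicator_one_le _)
        · simp
    _ ≤ δ / 2 + δ / 2 := by gcongr
    _ = δ := ENNReal.add_halves δ

end IsGaussianMixture

end Mixture

/-! ### Moments of Gaussian mixtures -/

/-- Measurable real functions on varying spaces, whose `Lᵖ` norms are bounded uniformly in the
space, for every positive integer `p`. -/
structure HasBoundedMoments {X : ℕ → Type*} [∀ c, MeasurableSpace (X c)]
    (ν : ∀ c, Measure (X c)) (Y : ∀ c, X c → ℝ) : Prop where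
  measurable : ∀ c, Measurable (Y c)
  exists_bound : ∀ p : ℕ, p ≠ 0 → ∃ B : ℝ≥0, ∀ c, eLpNorm (Y c) p (ν c) ≤ B

namespace HasBoundedMoments

variable {X : ℕ → Type*} [∀ c, MeasurableSpace (X c)] {ν : ∀ c, Measure (X c)}
  {Y Z : ∀ c, X c → ℝ}

lemma add (hY : HasBoundedMoments ν Y) (hZ : HasBoundedMoments ν Z) :
    HasBoundedMoments ν fun c x => Y c x + Z c x where
  measurable c := (hY.measurable c).add (hZ.measurable c)
  exists_bound p hp := by
    obtain ⟨B, hB⟩ := hY.exists_bound p hp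
    obtain ⟨B', hB'⟩ := hZ.exists_bound p hp
    refine ⟨B + B', fun c => ?_⟩
    have h1 : (1 : ENNReal) ≤ p := by exact_mod_cast Nat.one_le_iff_ne_zero.2 hp
    refine (eLpNorm_add_le (hY.measurable c).aestronglyMeasurable
      (hZ.measurable c).aestronglyMeasurable h1).trans ?_
    push_cast
    exact add_le_add (hB c) (hB' c)

lemma const_mul (hY : HasBoundedMoments ν Y) (r : ℝ) :
    HasBoundedMoments ν fun c x => r * Y c x where
  measurable c := (hY.measurable c).const_mul r
  exists_bound p hp := by
    obtain ⟨B, hB⟩ := hY.exists_bound p hp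
    refine ⟨‖r‖₊ * B, fun c => ?_⟩
    have := eLpNorm_const_smul r (Y c) (p : ENNReal) (ν c)
    have h2 : eLpNorm (fun x => r * Y c x) p (ν c) = ‖r‖ₑ * eLpNorm (Y c) p (ν c) := this
    rw [h2, ENNReal.coe_mul]
    exact mul_le_mul_right (hB c) _

lemma of_bounded [∀ c, IsProbabilityMeasure (ν c)] (hY : ∀ c, Measurable (Y c)) {B : ℝ}
    (hB : ∀ c x, |Y c x| ≤ B) : HasBoundedMoments ν Y where
  measurable := hY
  exists_bound p _ := by
    refine ⟨B.toNNReal, fun c =>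
      (eLpNorm_le_of_ae_bound (C := B) (Eventually.of_forall fun x => hB c x)).trans ?_⟩
    simp [ENNReal.ofReal]

lemma sum [∀ c, IsProbabilityMeasure (ν c)] {κ : Type*} (s : Finset κ) {Y : κ → ∀ c, X c → ℝ}
    (h : ∀ i ∈ s, HasBoundedMoments ν (Y i)) :
    HasBoundedMoments ν fun c x => ∑ i ∈ s, Y i c x := by
  classical
  induction s using Finset.induction_on with
  | empty => exact of_bounded (B := 0) (fun c => by simp) (fun c x => by simp)
  | insert i s hi ih =>
    simp only [Finset.sum_insert hi]
    exact (h i (by simp)).add (ih fun j hj => h j (by simp [hj]))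

end HasBoundedMoments

section GaussianMoments

lemma eLpNorm_pow_eq_lintegral {X : Type*} [MeasurableSpace X] {ν : Measure X} (f : X → ℝ) {p : ℕ}
    (hp : p ≠ 0) : eLpNorm f p ν ^ p = ∫⁻ x, ‖f x‖ₑ ^ p ∂ν := by
  have h := eLpNorm_nnreal_pow_eq_lintegral (f := f) (μ := ν) (p := (p : ℝ≥0))
    (by exact_mod_cast hp)
  simpa using h

/-- The moment of order `2 N` of `N(0, v)` is proportional to `v ^ N`. -/
lemma lintegral_pow_gaussianReal (N : ℕ) :
    ∃ C : ℝ≥0, ∀ v : ℝ≥0, ∫⁻ z, ‖z‖ₑ ^ (2 * N) ∂(gaussianReal 0 v) = C * (v : ENNReal) ^ N := by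
  have hfin : ∫⁻ z, ‖z‖ₑ ^ (2 * N) ∂(gaussianReal 0 1) ≠ ⊤ := by
    rcases eq_or_ne N 0 with rfl | hN
    · simp
    have h := (memLp_id_gaussianReal (μ := 0) (v := 1) ((2 * N : ℕ) : ℝ≥0)).eLpNorm_lt_top
    have h2 := eLpNorm_pow_eq_lintegral (ν := gaussianReal 0 1) id (p := 2 * N) (by omega)
    simp only [id] at h2
    rw [← h2]
    exact ENNReal.pow_ne_top (by simpa using h.ne)
  refine ⟨(∫⁻ z, ‖z‖ₑ ^ (2 * N) ∂(gaussianReal 0 1)).toNNReal, fun v => ?_⟩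
  rw [ENNReal.coe_toNNReal hfin]
  have hmap : gaussianReal 0 v = (gaussianReal 0 1).map (fun z => √v * z) := by
    rw [gaussianReal_map_const_mul]
    congr 1
    · simp
    · ext; simp
  have hv : ‖√(v : ℝ)‖ₑ ^ (2 * N) = (v : ENNReal) ^ N := by
    rw [pow_mul]
    congr 1
    rw [← enorm_pow, Real.sq_sqrt v.coe_nonneg]
    simp
  rw [hmap, lintegral_map (by fun_prop) (by fun_prop)]
  simp_rw [enorm_mul, mul_pow]
  rw [lintegral_const_mul _ (by fun_prop), hv, mul_comm]

/-- The moments of a polynomially bounded function under `N(0, v)` grow polynomially in `v`. -/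
lemma PolynomiallyBounded.exists_lintegral_le {φ : ℝ → ℝ} (hpoly : PolynomiallyBounded φ) {p : ℕ}
    (hp : p ≠ 0) :
    ∃ (A : ℝ≥0) (N : ℕ), N ≠ 0 ∧ ∀ v : ℝ≥0,
      ∫⁻ z, ‖φ z ^ 2‖ₑ ^ p ∂(gaussianReal 0 v) ≤ A * (1 + (v : ENNReal) ^ N) := by
  obtain ⟨K, r, hK⟩ := hpoly
  -- The degree `r` is raised by one so that the exponent `N` is nonzero.
  set N := (r + 1) * p with hN
  obtain ⟨C, hC⟩ := lintegral_pow_gaussianReal N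
  set D : ℝ≥0 := (‖K‖₊ * 2 ^ (r + 1)) ^ (2 * p) with hD
  have hpt : ∀ z, ‖φ z ^ 2‖ₑ ^ p ≤ (D : ENNReal) * (1 + ‖z‖ₑ ^ (2 * N)) := by
    intro z
    have h1 : |φ z| ^ (2 * p) ≤ D * (1 + |z| ^ (2 * N)) := by
      have h2 : |φ z| ≤ |K| * (1 + |z|) ^ (r + 1) := by
        refine (hK z).trans ?_
        have h3 : (1 + |z|) ^ r ≤ (1 + |z|) ^ (r + 1) :=
          pow_le_pow_right₀ (by linarith [abs_nonneg z]) (Nat.le_succ r)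
        have h4 : (0 : ℝ) ≤ (1 + |z|) ^ r := by positivity
        exact mul_le_mul (le_abs_self K) h3 h4 (abs_nonneg K)
      calc |φ z| ^ (2 * p) ≤ (|K| * (1 + |z|) ^ (r + 1)) ^ (2 * p) := by gcongr
        _ = |K| ^ (2 * p) * (1 + |z|) ^ (2 * N) := by rw [mul_pow, ← pow_mul, hN]; ring_nf
        _ ≤ |K| ^ (2 * p) * (2 ^ (2 * N - 1) * (1 ^ (2 * N) + |z| ^ (2 * N))) := by
            gcongr
            exact add_pow_le zero_le_one (abs_nonneg z) _
        _ ≤ |K| ^ (2 * p) * (2 ^ (2 * N) * (1 ^ (2 * N) + |z| ^ (2 * N))) := by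
            gcongr
            · norm_num
            · omega
        _ = D * (1 + |z| ^ (2 * N)) := by
            rw [hD, hN]; push_cast
            rw [mul_pow, ← pow_mul, one_pow, Real.norm_eq_abs]; ring_nf
    have h5 : ‖φ z ^ 2‖ₑ ^ p = ENNReal.ofReal (|φ z| ^ (2 * p)) := by
      rw [← enorm_pow, ← pow_mul, Real.enorm_eq_ofReal_abs, abs_pow]
    have h6 : (D : ENNReal) * (1 + ‖z‖ₑ ^ (2 * N)) =
        ENNReal.ofReal (D * (1 + |z| ^ (2 * N))) := by
      rw [ENNReal.ofReal_mul D.coe_nonneg, ENNReal.ofReal_add zero_le_one (by positivity),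
        ENNReal.ofReal_pow (abs_nonneg z), Real.enorm_eq_ofReal_abs]
      simp
    rw [h5, h6]
    exact ENNReal.ofReal_le_ofReal h1
  refine ⟨D * (1 + C), N, by positivity, fun v => ?_⟩
  calc _ ≤ ∫⁻ z, (D : ENNReal) * (1 + ‖z‖ₑ ^ (2 * N)) ∂(gaussianReal 0 v) := lintegral_mono hpt
    _ = D * (1 + C * (v : ENNReal) ^ N) := by
        rw [lintegral_const_mul _ (by fun_prop), lintegral_add_left measurable_const, hC]
        simp
    _ ≤ D * ((1 + C) * (1 + (v : ENNReal) ^ N)) := by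
        gcongr
        have : (1 + (C : ENNReal)) * (1 + (v : ENNReal) ^ N) =
            (1 + C * (v : ENNReal) ^ N) + (C + (v : ENNReal) ^ N) := by ring
        rw [this]
        exact le_self_add
    _ = _ := by push_cast; ring

end GaussianMoments

namespace IsGaussianMixture

variable {ι : Type*} [Fintype ι] [DecidableEq ι]

/-- One coordinate of one channel of a mixture is a mixture of real Gaussians. -/
lemma lintegral_eval_eq {c : ℕ} {X : Type*} [MeasurableSpace X]
    {μ : Measure (Fin c → EuclideanSpace ℝ ι)} {ν : Measure X} {L : X → Matrix ι ι ℝ}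
    (h : IsGaussianMixture μ ν L) {f : ℝ → ENNReal} (hf : Measurable f) (i : Fin c) (a : ι) :
    ∫⁻ y, f (y i a) ∂μ = ∫⁻ x, ∫⁻ z, f z ∂(gaussianReal 0 (L x a a).toNNReal) ∂ν := by
  rw [h.lintegral_eq (by fun_prop)]
  refine lintegral_congr fun x => ?_
  have h1 := (measurePreserving_eval (fun _ : Fin c => multivariateGaussian 0 (L x)) i)
  have h2 := measurePreserving_eval_multivariateGaussian (μ := 0) (h.posSemidef x) (i := a)
  exact (h2.comp h1).lintegral_comp hf

lemma integral_eval_mul_pi {c : ℕ} {K : Matrix ι ι ℝ} (hK : K.PosSemidef) (j : Fin c) (a a' : ι) :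
    ∫ y, y j a * y j a' ∂(Measure.pi fun _ : Fin c => multivariateGaussian 0 K) = K a a' := by
  rw [integral_comp_eval_pi (multivariateGaussian 0 K) (f := fun z => z a * z a') (by fun_prop) j]
  have h2 : ∀ b : ι, MemLp (fun z : EuclideanSpace ℝ ι => z b) 2 (multivariateGaussian 0 K) :=
    fun b => memLp_activation (φ := fun x => x) (fun v => memLp_id_gaussianReal 2) hK b
  have h0 : ∀ b : ι, ∫ z : EuclideanSpace ℝ ι, z b ∂(multivariateGaussian 0 K) = 0 := by
    intro b
    have hmp := measurePreserving_eval_multivariateGaussian (μ := 0) hK (i := b)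
    have := integral_map (μ := multivariateGaussian 0 K) (φ := fun h => h b)
      hmp.measurable.aemeasurable (f := fun x => x) (by fun_prop)
    rw [← this, hmp.map_eq]
    simp
  have := covariance_eval_multivariateGaussian (μ := 0) hK a a'
  rw [covariance_eq_sub (h2 a) (h2 a')] at this
  simpa [h0] using this

lemma integral_eval_pi {c : ℕ} {K : Matrix ι ι ℝ} (hK : K.PosSemidef) (j : Fin c) (a : ι) :
    ∫ y, y j a ∂(Measure.pi fun _ : Fin c => multivariateGaussian 0 K) = 0 := by
  rw [integral_comp_eval_pi (multivariateGaussian 0 K) (f := fun z => z a) (by fun_prop) j]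
  have hmp := measurePreserving_eval_multivariateGaussian (μ := 0) hK (i := a)
  have := integral_map (μ := multivariateGaussian 0 K) (φ := fun h => h a)
    hmp.measurable.aemeasurable (f := fun x => x) (by fun_prop)
  rw [← this, hmp.map_eq]
  simp

variable {X : ℕ → Type*} [∀ c, MeasurableSpace (X c)]
  {μ : ∀ c, Measure (Fin c → EuclideanSpace ℝ ι)} {ν : ∀ c, Measure (X c)}
  [∀ c, IsProbabilityMeasure (ν c)] {L : ∀ c, X c → Matrix ι ι ℝ} {S : Matrix ι ι ℝ}
  (h : ∀ c, IsGaussianMixture (μ c) (ν c) (L c))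
include h

/-- Moments of the squared activations, bounded uniformly in the width and in the channel. -/
lemma exists_eLpNorm_activation_sq_le {φ : ℝ → ℝ} (hφ : Continuous φ)
    (hpoly : PolynomiallyBounded φ) {a : ι} (hL : HasBoundedMoments ν fun c x => L c x a a)
    {p : ℕ} (hp : p ≠ 0) :
    ∃ B : ℝ≥0, ∀ c (i : Fin c), eLpNorm (fun y => φ (y i a) ^ 2) p (μ c) ≤ B := by
  obtain ⟨A, N, hN, hA⟩ := hpoly.exists_lintegral_le hp
  obtain ⟨B, hB⟩ := hL.exists_bound N hN
  set D : ℝ≥0 := A * (1 + B ^ N) with hD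
  refine ⟨D + 1, fun c i => ?_⟩
  have hle : eLpNorm (fun y => φ (y i a) ^ 2) p (μ c) ^ p ≤ D := by
    rw [eLpNorm_pow_eq_lintegral _ hp,
      (h c).lintegral_eval_eq (f := fun z => ‖φ z ^ 2‖ₑ ^ p) (by fun_prop) i a]
    calc _ ≤ ∫⁻ x, (A : ENNReal) * (1 + ‖L c x a a‖ₑ ^ N) ∂(ν c) := by
          refine lintegral_mono fun x => (hA _).trans ?_
          gcongr
          rw [Real.enorm_eq_ofReal_abs]
          exact ENNReal.ofReal_le_ofReal (le_abs_self _)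
      _ = A * (1 + eLpNorm (fun x => L c x a a) N (ν c) ^ N) := by
          have hm := hL.measurable c
          rw [lintegral_const_mul _ (by fun_prop), lintegral_add_left measurable_const,
            eLpNorm_pow_eq_lintegral _ hN]
          simp
      _ ≤ D := by
          rw [hD]; push_cast
          gcongr
          exact hB c
  -- A number whose `p`-th power is at most `D` is at most `D + 1`, as `(D + 1) ≤ (D + 1) ^ p`.
  refine le_of_not_gt fun hcon => ?_
  have h1 : ((D + 1 : ℝ≥0) : ENNReal) ≤ ((D + 1 : ℝ≥0) : ENNReal) ^ p :=
    le_self_pow₀ (by push_cast; exact le_add_self) hp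
  have h2 : ((D + 1 : ℝ≥0) : ENNReal) ≤ D :=
    h1.trans ((pow_le_pow_left₀ zero_le hcon.le p).trans hle)
  have h3 : D + 1 ≤ D := by exact_mod_cast h2
  exact absurd h3 (by simp)

/-- Bounded moments of the covariances pass to the empirical second moments of the activations. -/
lemma hasBoundedMoments_average {φ : ℝ → ℝ} (hφ : Continuous φ) (hpoly : PolynomiallyBounded φ)
    (hL : ∀ a, HasBoundedMoments ν fun c x => L c x a a) (a a' : ι) :
    HasBoundedMoments μ fun c y => 1 / (c : ℝ) * ∑ i, φ (y i a) * φ (y i a') where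
  measurable c := Continuous.measurable (by fun_prop)
  exists_bound p hp := by
    obtain ⟨B, hB⟩ := exists_eLpNorm_activation_sq_le h hφ hpoly (hL a) hp
    obtain ⟨B', hB'⟩ := exists_eLpNorm_activation_sq_le h hφ hpoly (hL a') hp
    refine ⟨B + B', fun c => ?_⟩
    have h1 : (1 : ENNReal) ≤ p := by exact_mod_cast Nat.one_le_iff_ne_zero.2 hp
    have hsq : ∀ (i : Fin c) b, AEStronglyMeasurable
        (fun y : Fin c → EuclideanSpace ℝ ι => φ (y i b) ^ 2) (μ c) := fun i b =>
      Continuous.aestronglyMeasurable (by fun_prop)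
    have hi : ∀ i : Fin c, eLpNorm (fun y : Fin c → EuclideanSpace ℝ ι =>
        φ (y i a) * φ (y i a')) p (μ c) ≤ ((B + B' : ℝ≥0) : ENNReal) := by
      intro i
      refine (eLpNorm_mono_real (g := fun y => φ (y i a) ^ 2 + φ (y i a') ^ 2)
        fun y => ?_).trans ?_
      · rw [Real.norm_eq_abs, abs_le]
        constructor <;> nlinarith [sq_nonneg (φ (y i a) + φ (y i a')),
          sq_nonneg (φ (y i a) - φ (y i a')), sq_nonneg (φ (y i a)), sq_nonneg (φ (y i a'))]
      · refine (eLpNorm_add_le (hsq i a) (hsq i a') h1).trans ?_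
        push_cast
        exact add_le_add (hB c i) (hB' c i)
    have hsum := eLpNorm_sum_le (μ := μ c) (p := p) (s := Finset.univ)
      (f := fun (i : Fin c) (y : Fin c → EuclideanSpace ℝ ι) => φ (y i a) * φ (y i a'))
      (fun i _ => Continuous.aestronglyMeasurable (by fun_prop)) h1
    have hcm := eLpNorm_const_smul (1 / (c : ℝ))
      (∑ i : Fin c, fun y : Fin c → EuclideanSpace ℝ ι => φ (y i a) * φ (y i a')) (p : ENNReal)
      (μ c)
    have heq : (fun y : Fin c → EuclideanSpace ℝ ι => 1 / (c : ℝ) * ∑ i, φ (y i a) * φ (y i a')) =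
        (1 / (c : ℝ)) •
          ∑ i : Fin c, fun y : Fin c → EuclideanSpace ℝ ι => φ (y i a) * φ (y i a') := by
      ext y; simp
    rw [heq, hcm]
    rcases Nat.eq_zero_or_pos c with rfl | hc
    · simp
    have hc' : (0 : ℝ) < c := by exact_mod_cast hc
    calc _ ≤ ‖1 / (c : ℝ)‖ₑ * ∑ _i : Fin c, ((B + B' : ℝ≥0) : ENNReal) := by
          gcongr
          exact hsum.trans (Finset.sum_le_sum fun i _ => hi i)
      _ = ((B + B' : ℝ≥0) : ENNReal) := by
          have : ‖1 / (c : ℝ)‖ₑ = (c : ENNReal)⁻¹ := by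
            rw [Real.enorm_eq_ofReal (by positivity), one_div, ENNReal.ofReal_inv_of_pos hc',
              ENNReal.ofReal_natCast]
          rw [this, Finset.sum_const, Finset.card_univ, Fintype.card_fin, nsmul_eq_mul, ← mul_assoc,
            ENNReal.inv_mul_cancel (by exact_mod_cast hc.ne') (by simp), one_mul]

omit [∀ c, IsProbabilityMeasure (ν c)] in
lemma memLp_eval {a : ι} (hL : HasBoundedMoments ν fun c x => L c x a a) (c : ℕ) (j : Fin c) :
    MemLp (fun y => y j a) 2 (μ c) := by
  refine ⟨Continuous.aestronglyMeasurable (by fun_prop), ?_⟩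
  obtain ⟨B, hB⟩ := hL.exists_bound 1 one_ne_zero
  obtain ⟨C, hC⟩ := lintegral_pow_gaussianReal 1
  have h1 := eLpNorm_pow_eq_lintegral (ν := μ c) (fun y => y j a) (p := 2) two_ne_zero
  rw [(h c).lintegral_eval_eq (f := fun z => ‖z‖ₑ ^ 2) (by fun_prop)] at h1
  simp only [mul_one, pow_one] at hC
  simp_rw [hC] at h1
  have h2 : ∫⁻ x, (C : ENNReal) * ((L c x a a).toNNReal : ENNReal) ∂(ν c) < ⊤ := by
    have hm := hL.measurable c
    calc _ ≤ ∫⁻ x, (C : ENNReal) * ‖L c x a a‖ₑ ∂(ν c) := by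
          refine lintegral_mono fun x => ?_
          gcongr
          rw [Real.enorm_eq_ofReal_abs]
          exact ENNReal.ofReal_le_ofReal (le_abs_self _)
      _ = C * eLpNorm (fun x => L c x a a) 1 (ν c) := by
          rw [lintegral_const_mul _ (by fun_prop), eLpNorm_one_eq_lintegral_enorm]
      _ < ⊤ := ENNReal.mul_lt_top ENNReal.coe_lt_top
          ((by simpa using hB c : eLpNorm (fun x => L c x a a) 1 (ν c) ≤ B).trans_lt
            ENNReal.coe_lt_top)
  rw [← h1] at h2
  simpa using h2

lemma integral_eval {a : ι} (hL : HasBoundedMoments ν fun c x => L c x a a) (c : ℕ) (j : Fin c) :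
    ∫ y, y j a ∂(μ c) = 0 := by
  have := fun c => (h c).isProbabilityMeasure
  rw [(h c).integral_eq ((memLp_eval h hL c j).integrable (by norm_num))]
  simp_rw [fun x => integral_eval_pi ((h c).posSemidef x) j a]
  simp

lemma integral_eval_mul (hL : ∀ a, HasBoundedMoments ν fun c x => L c x a a) (c : ℕ) (j : Fin c)
    (a a' : ι) : ∫ y, y j a * y j a' ∂(μ c) = ∫ x, L c x a a' ∂(ν c) := by
  rw [(h c).integral_eq (f := fun y => y j a * y j a')
    ((memLp_eval h (hL a) c j).integrable_mul (memLp_eval h (hL a') c j))]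
  simp_rw [fun x => integral_eval_mul_pi ((h c).posSemidef x) j a a']

end IsGaussianMixture

/-! ### A single random layer -/

section Independence

/-- If `X` is independent of the pair `(Y, Z)`, and `Y` is independent of `Z`, then the pair
`(X, Y)` is independent of `Z`. -/
lemma indepFun_prodMk_left_of_indepFun {Ω α β γ : Type*} [MeasurableSpace Ω] [MeasurableSpace α]
    [MeasurableSpace β] [MeasurableSpace γ] {P : Measure Ω} [IsProbabilityMeasure P]
    {X : Ω → α} {Y : Ω → β} {Z : Ω → γ} (hX : AEMeasurable X P) (hY : AEMeasurable Y P)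
    (hZ : AEMeasurable Z P) (h : IndepFun X (fun ω => (Y ω, Z ω)) P) (hYZ : IndepFun Y Z P) :
    IndepFun (fun ω => (X ω, Y ω)) Z P := by
  have := Measure.isProbabilityMeasure_map hX
  have := Measure.isProbabilityMeasure_map hY
  have := Measure.isProbabilityMeasure_map hZ
  have hXY : IndepFun X Y P := h.comp (φ := id) (ψ := Prod.fst) measurable_id measurable_fst
  rw [indepFun_iff_map_prod_eq_prod_map_map hX (hY.prodMk hZ),
    (indepFun_iff_map_prod_eq_prod_map_map hY hZ).1 hYZ] at h
  rw [indepFun_iff_map_prod_eq_prod_map_map (hX.prodMk hY) hZ,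
    (indepFun_iff_map_prod_eq_prod_map_map hX hY).1 hXY]
  have h2 := (measurePreserving_prodAssoc (P.map X) (P.map Y) (P.map Z)).symm.map_eq
  rw [← h2, ← h, AEMeasurable.map_map_of_aemeasurable (by fun_prop)
    (hX.prodMk (hY.prodMk hZ))]
  rfl

lemma measurable_map_prodMk {α β γ : Type*} [MeasurableSpace α] [MeasurableSpace β]
    [MeasurableSpace γ] (ν : Measure β) [SFinite ν] {F : α × β → γ} (hF : Measurable F) :
    Measurable fun x => ν.map fun y => F (x, y) := by
  refine Measure.measurable_of_measurable_coe _ fun s hs => ?_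
  have : (fun x => (ν.map fun y => F (x, y)) s) = fun x => ν (Prod.mk x ⁻¹' (F ⁻¹' s)) := by
    ext x
    rw [Measure.map_apply (by fun_prop) hs]
    rfl
  rw [this]
  exact measurable_measure_prodMk_left (hF hs)

lemma map_prod_eq_bind {α β γ : Type*} [MeasurableSpace α] [MeasurableSpace β]
    [MeasurableSpace γ] (μ : Measure α) (ν : Measure β) [SFinite ν] {F : α × β → γ}
    (hF : Measurable F) : (μ.prod ν).map F = μ.bind fun x => ν.map fun y => F (x, y) := by
  ext s hs
  rw [Measure.map_apply hF hs, Measure.prod_apply (hF hs),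
    Measure.bind_apply hs (measurable_map_prodMk ν hF).aemeasurable]
  refine lintegral_congr fun x => ?_
  rw [Measure.map_apply (by fun_prop) hs]
  rfl

end Independence

section Layer

variable {n k c : ℕ} {φ : ℝ → ℝ} {σw σb : ℝ≥0}

/-- Indices of the weights and biases between two consecutive layers. -/
abbrev LayerIndex (k c : ℕ) : Type := (Fin c × Fin c × KernelWindow k) ⊕ Fin c

/-- One layer of the network, as a function of its input `x` and its weights and biases `θ`. -/
def layerMap (φ : ℝ → ℝ) (x : Fin c → EuclideanSpace ℝ (ZMod n)) (θ : LayerIndex k c → ℝ) :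
    Fin c → EuclideanSpace ℝ (ZMod n) :=
  fun j => WithLp.toLp 2 fun α =>
    (∑ i : Fin c, ∑ β : KernelWindow k,
      φ (x i (α + ((β : ℤ) : ZMod n))) * θ (Sum.inl (i, j, β))) + θ (Sum.inr j)

lemma continuous_layerMap (hφ : Continuous φ) :
    Continuous fun p : (Fin c → EuclideanSpace ℝ (ZMod n)) × (LayerIndex k c → ℝ) =>
      layerMap φ p.1 p.2 := by
  unfold layerMap
  fun_prop

/-- The variances of the weights and biases of one layer. -/
def layerVar (k c : ℕ) (σw σb : ℝ≥0) : LayerIndex k c → ℝ≥0 :=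
  Sum.elim (fun _ => σw ^ 2 / ((c : ℝ≥0) * (2 * (k : ℝ≥0) + 1))) (fun _ => σb ^ 2)

/-- The law of the weights and biases of one layer. -/
def layerLaw (k c : ℕ) (σw σb : ℝ≥0) : Measure (LayerIndex k c → ℝ) :=
  Measure.pi fun s => gaussianReal 0 (layerVar k c σw σb s)

instance : IsProbabilityMeasure (layerLaw k c σw σb) := by unfold layerLaw; infer_instance

/-- The conditional covariance matrix of any channel of the next layer, given the pre-activations
`x` of the current layer. -/
def condCov (k : ℕ) (φ : ℝ → ℝ) (σw σb : ℝ≥0) (x : Fin c → EuclideanSpace ℝ (ZMod n)) :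
    Matrix (ZMod n) (ZMod n) ℝ :=
  diagAverage k (Matrix.of fun α α' =>
    (σw : ℝ) ^ 2 * (1 / (c : ℝ) * ∑ i, φ (x i α) * φ (x i α')) + (σb : ℝ) ^ 2)

lemma card_kernelWindow (k : ℕ) : Fintype.card (KernelWindow k) = 2 * k + 1 := by
  simp
  omega

variable [NeZero n]

lemma measurable_condCov_entry (hφ : Continuous φ) (α α' : ZMod n) :
    Measurable fun x : Fin c → EuclideanSpace ℝ (ZMod n) => condCov k φ σw σb x α α' := by
  refine Continuous.measurable ?_
  simp only [condCov, diagAverage, Matrix.of_apply]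
  fun_prop

open Matrix in
/-- The quadratic form of the conditional covariance matrix is the variance of the corresponding
linear combination of the pre-activations, a sum over the weights and biases of one channel. -/
lemma dotProduct_condCov_mulVec (x : Fin c → EuclideanSpace ℝ (ZMod n)) (t : ZMod n → ℝ) :
    t ⬝ᵥ condCov k φ σw σb x *ᵥ t =
      (∑ i : Fin c, ∑ β : KernelWindow k, (∑ α, t α * φ (x i (α + ((β : ℤ) : ZMod n)))) ^ 2 *
        ((σw : ℝ) ^ 2 / (c * (2 * k + 1)))) + (∑ α, t α) ^ 2 * (σb : ℝ) ^ 2 := by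
  have hk : (0 : ℝ) < 2 * k + 1 := by positivity
  have hcard : ∑ _β : KernelWindow k, (1 : ℝ) = 2 * k + 1 := by
    rw [Finset.sum_const, Finset.card_univ, card_kernelWindow]
    simp
  have hsq : ∀ u : ZMod n → ℝ, (∑ α, t α * u α) ^ 2 =
      ∑ α, ∑ α', t α * t α' * (u α * u α') := by
    intro u
    rw [sq, Finset.sum_mul_sum]
    exact Finset.sum_congr rfl fun α _ => Finset.sum_congr rfl fun α' _ => by ring
  have hone : (∑ α, t α) ^ 2 = ∑ α, ∑ α', t α * t α' := by
    have := hsq fun _ => 1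
    simpa using this
  have hL : t ⬝ᵥ condCov k φ σw σb x *ᵥ t = ∑ β : KernelWindow k, ∑ α, ∑ α', t α * t α' *
      (1 / (2 * (k : ℝ) + 1) * ((σw : ℝ) ^ 2 * (1 / (c : ℝ) *
        ∑ i, φ (x i (α + ((β : ℤ) : ZMod n))) * φ (x i (α' + ((β : ℤ) : ZMod n)))) +
          (σb : ℝ) ^ 2)) := by
    simp only [dotProduct, mulVec, condCov, diagAverage, of_apply]
    rw [Finset.sum_comm]
    refine Finset.sum_congr rfl fun α _ => ?_
    rw [Finset.sum_comm, Finset.mul_sum]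
    refine Finset.sum_congr rfl fun α' _ => ?_
    rw [Finset.mul_sum, Finset.sum_mul, Finset.mul_sum]
    exact Finset.sum_congr rfl fun β _ => by ring
  have hR : ∀ β : KernelWindow k, ∑ α, ∑ α', t α * t α' *
      (1 / (2 * (k : ℝ) + 1) * ((σw : ℝ) ^ 2 * (1 / (c : ℝ) *
        ∑ i, φ (x i (α + ((β : ℤ) : ZMod n))) * φ (x i (α' + ((β : ℤ) : ZMod n)))) +
          (σb : ℝ) ^ 2)) =
      ∑ i, (∑ α, t α * φ (x i (α + ((β : ℤ) : ZMod n)))) ^ 2 *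
        ((σw : ℝ) ^ 2 / (c * (2 * k + 1))) +
      (∑ α, t α) ^ 2 * (σb : ℝ) ^ 2 * (1 / (2 * (k : ℝ) + 1)) * 1 := by
    intro β
    simp_rw [hsq, hone, Finset.sum_mul]
    rw [Finset.sum_comm]
    rw [Finset.sum_comm (s := (Finset.univ : Finset (Fin c)))]
    rw [Finset.sum_comm, ← Finset.sum_add_distrib]
    refine Finset.sum_congr rfl fun α _ => ?_
    rw [Finset.sum_comm, ← Finset.sum_add_distrib]
    refine Finset.sum_congr rfl fun α' _ => ?_
    rw [mul_add, mul_add, Finset.mul_sum, Finset.mul_sum, Finset.mul_sum, Finset.mul_sum]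
    congr 1
    · refine Finset.sum_congr rfl fun i _ => ?_
      rw [div_eq_mul_inv (_ ^ 2), mul_inv]
      ring
    · ring
  rw [hL]
  simp_rw [hR]
  rw [Finset.sum_add_distrib, ← Finset.mul_sum, hcard, Finset.sum_comm]
  congr 1
  field_simp

lemma posSemidef_condCov (x : Fin c → EuclideanSpace ℝ (ZMod n)) :
    (condCov k φ σw σb x).PosSemidef := by
  refine Matrix.PosSemidef.of_dotProduct_mulVec_nonneg ?_ fun t => ?_
  · ext α α'
    simp only [Matrix.conjTranspose_apply, star_trivial, condCov, diagAverage, Matrix.of_apply,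
      mul_comm]
  · rw [star_trivial, dotProduct_condCov_mulVec]
    positivity

/-- Given the input of a layer, its channels are i.i.d. centred Gaussian vectors. Both sides are
compared through their characteristic functions, for which the channels are assembled into one
Euclidean space. -/
lemma map_layerMap_layerLaw (hφ : Continuous φ) (x : Fin c → EuclideanSpace ℝ (ZMod n)) :
    (layerLaw k c σw σb).map (layerMap φ x) =
      Measure.pi fun _ : Fin c => multivariateGaussian 0 (condCov k φ σw σb x) := by
  have hm : Measurable (layerMap (k := k) φ x) :=
    ((continuous_layerMap hφ).comp (Continuous.prodMk_right x)).measurable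
  suffices h : ((layerLaw k c σw σb).map (layerMap φ x)).map
      (MeasurableEquiv.toLp 2 (Fin c → EuclideanSpace ℝ (ZMod n))) =
      (Measure.pi fun _ : Fin c => multivariateGaussian 0 (condCov k φ σw σb x)).map
        (MeasurableEquiv.toLp 2 (Fin c → EuclideanSpace ℝ (ZMod n))) by
    exact (MeasurableEquiv.map_measurableEquiv_injective _) h
  refine Measure.ext_of_charFun ?_
  ext t
  -- The linear form `t` of the output is the linear form `a` of the weights and biases.
  set a : LayerIndex k c → ℝ := Sum.elim
    (fun q => ∑ α, t q.2.1 α * φ (x q.1 (α + ((q.2.2 : ℤ) : ZMod n))))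
    (fun j => ∑ α, t j α) with ha
  have hinner : ∀ θ : LayerIndex k c → ℝ,
      inner ℝ (WithLp.toLp 2 (layerMap φ x θ)) t = inner ℝ (WithLp.toLp 2 θ) (WithLp.toLp 2 a) := by
    intro θ
    simp only [PiLp.inner_apply, layerMap, Fintype.sum_sum_type, ha, Sum.elim_inl, Sum.elim_inr,
      RCLike.inner_apply, conj_trivial, Fintype.sum_prod_type]
    rw [Finset.sum_comm (s := (Finset.univ : Finset (Fin c)))
      (f := fun i j => ∑ β : KernelWindow k, _), ← Finset.sum_add_distrib]
    refine Finset.sum_congr rfl fun j _ => ?_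
    simp only [mul_add, Finset.sum_add_distrib, Finset.sum_mul, Finset.mul_sum]
    congr 1
    rw [Finset.sum_comm]
    refine Finset.sum_congr rfl fun i _ => ?_
    rw [Finset.sum_comm]
    refine Finset.sum_congr rfl fun β _ => ?_
    refine Finset.sum_congr rfl fun α _ => ?_
    ring
  have hL : charFun (((layerLaw k c σw σb).map (layerMap φ x)).map
      (MeasurableEquiv.toLp 2 (Fin c → EuclideanSpace ℝ (ZMod n)))) t =
      charFun ((layerLaw k c σw σb).map (WithLp.toLp 2)) (WithLp.toLp 2 a) := by
    rw [charFun_apply, charFun_apply, integral_map_equiv, integral_map hm.aemeasurable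
      (Continuous.aestronglyMeasurable (by
        simp only [MeasurableEquiv.coe_toLp]; fun_prop)),
      integral_map (by fun_prop) (Continuous.aestronglyMeasurable (by fun_prop))]
    refine integral_congr_ae (Eventually.of_forall fun θ => ?_)
    simp only [MeasurableEquiv.coe_toLp, hinner]
  rw [hL, layerLaw, charFun_pi, MeasurableEquiv.coe_toLp, charFun_pi]
  simp_rw [charFun_gaussianReal, charFun_multivariateGaussian (posSemidef_condCov x),
    dotProduct_condCov_mulVec]
  rw [← Complex.exp_sum, ← Complex.exp_sum]
  congr 1
  simp only [Fintype.sum_sum_type, Fintype.sum_prod_type, ha, layerVar, Sum.elim_inl,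
    Sum.elim_inr, inner_zero_right]
  rw [Finset.sum_comm (s := (Finset.univ : Finset (Fin c)))
      (f := fun i j => ∑ β : KernelWindow k, _), ← Finset.sum_add_distrib]
  refine Finset.sum_congr rfl fun j _ => ?_
  push_cast
  simp only [zero_mul, mul_zero, zero_sub, add_div, neg_add, Finset.sum_div, Finset.sum_neg_distrib]
  congr 1
  · congr 1
    refine Finset.sum_congr rfl fun i _ => Finset.sum_congr rfl fun β _ => ?_
    ring
  · ring

end Layer

/-! ### Independence of the layers -/

section Network

variable {n k c : ℕ} {φ : ℝ → ℝ} {σw σb : ℝ≥0}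

lemma continuous_preact (hφ : Continuous φ) (l : ℕ) :
    Continuous fun p : (Fin c → EuclideanSpace ℝ (ZMod n)) ×
        ((ℕ × Fin c × Fin c × KernelWindow k) ⊕ (ℕ × Fin c) → ℝ) =>
      preact φ (fun l i j β => p.2 (Sum.inl (l, i, j, β))) (fun l j => p.2 (Sum.inr (l, j)))
        p.1 l := by
  induction l with
  | zero => exact continuous_fst
  | succ l ih =>
    simp only [preact]
    fun_prop

/-- The pre-activations at layer `l` depend only on the weights and biases of the layers
below `l`. -/
lemma preact_congr {W W' : ℕ → Fin c → Fin c → KernelWindow k → ℝ} {b b' : ℕ → Fin c → ℝ}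
    (x : Fin c → EuclideanSpace ℝ (ZMod n)) {l : ℕ} (hW : ∀ l' < l, W l' = W' l')
    (hb : ∀ l' < l, b l' = b' l') : preact φ W b x l = preact φ W' b' x l := by
  induction l with
  | zero => rfl
  | succ l ih =>
    simp only [preact]
    rw [ih (fun l' h => hW l' (by omega)) (fun l' h => hb l' (by omega)), hW l (by omega),
      hb l (by omega)]

/-- The position of the weights and biases that lead from layer `l` to layer `l + 1` among all the
parameters. -/
def layerEmbedding (k c l : ℕ) :
    LayerIndex k c ↪ (ℕ × Fin c × Fin c × KernelWindow k) ⊕ (ℕ × Fin c) where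
  toFun := Sum.map (fun q => (l, q)) (fun j => (l, j))
  inj' := Function.Injective.sumMap (Prod.mk_right_injective l) (Prod.mk_right_injective l)

/-- The parameters of the layers below `l`. -/
def pastIndices (k c l : ℕ) : Finset ((ℕ × Fin c × Fin c × KernelWindow k) ⊕ (ℕ × Fin c)) :=
  (Finset.range l ×ˢ Finset.univ).disjSum (Finset.range l ×ˢ Finset.univ)

lemma disjoint_pastIndices_map_layerEmbedding (k c l : ℕ) :
    Disjoint (pastIndices k c l) (Finset.univ.map (layerEmbedding k c l)) := by
  rw [Finset.disjoint_left]
  rintro (⟨l', q⟩ | ⟨l', j⟩) h1 h2 <;>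
    simp [pastIndices, layerEmbedding] at h1 h2 <;> omega

variable {Ω : Type*} [MeasurableSpace Ω] {P : Measure Ω}
  {W : ℕ → Fin c → Fin c → KernelWindow k → Ω → ℝ} {b : ℕ → Fin c → Ω → ℝ}
  {h₀ : Fin c → Ω → EuclideanSpace ℝ (ZMod n)}

lemma IsGaussianInit.aemeasurable_cnnParams (hinit : IsGaussianInit σw σb P W b)
    (p : (ℕ × Fin c × Fin c × KernelWindow k) ⊕ (ℕ × Fin c)) :
    AEMeasurable (cnnParams W b p) P := by
  rcases p with p | p
  · exact (hinit.weight_law _ _ _ _).aemeasurable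
  · exact (hinit.bias_law _ _).aemeasurable

variable [NeZero n]

lemma IsGaussianInit.aemeasurable_randomPreact (hinit : IsGaussianInit σw σb P W b)
    (hφ : Continuous φ) (hm : AEMeasurable (fun ω j => h₀ j ω) P) (l : ℕ) :
    AEMeasurable (fun ω j => randomPreact φ W b h₀ l j ω) P := by
  have hp : AEMeasurable (fun ω p => cnnParams W b p ω) P :=
    aemeasurable_pi_iff.2 hinit.aemeasurable_cnnParams
  exact (continuous_preact (n := n) (k := k) (c := c) hφ l).measurable.comp_aemeasurable
    (hm.prodMk hp)

variable [IsProbabilityMeasure P]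

lemma IsGaussianInit.map_layer (hinit : IsGaussianInit σw σb P W b) (l : ℕ) :
    P.map (fun ω s => cnnParams W b (layerEmbedding k c l s) ω) = layerLaw k c σw σb := by
  have h := hinit.indep.precomp (layerEmbedding k c l).injective
  refine ((iIndepFun_iff_map_fun_eq_pi_map fun s => hinit.aemeasurable_cnnParams _).1 h).trans ?_
  rw [layerLaw]
  congr 1
  ext1 s
  rcases s with q | j
  · exact (hinit.weight_law _ _ _ _).map_eq
  · exact (hinit.bias_law _ _).map_eq

/-- The pre-activations at layer `l` are independent of the weights and biases that lead to the
next layer. -/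
lemma IsGaussianInit.indepFun_randomPreact (hinit : IsGaussianInit σw σb P W b)
    (hφ : Continuous φ) (hm : AEMeasurable (fun ω j => h₀ j ω) P)
    (hi : IndepFun (fun ω j => h₀ j ω) (fun ω p => cnnParams W b p ω) P) (l : ℕ) :
    IndepFun (fun ω j => randomPreact φ W b h₀ l j ω)
      (fun ω s => cnnParams W b (layerEmbedding k c l s) ω) P := by
  classical
  set A := pastIndices k c l with hA
  set T := Finset.univ.map (layerEmbedding k c l) with hT
  have hYZ := hinit.indep.indepFun_finset₀ A T
    (disjoint_pastIndices_map_layerEmbedding k c l) hinit.aemeasurable_cnnParams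
  have hYm : AEMeasurable (fun ω (i : A) => cnnParams W b i ω) P :=
    aemeasurable_pi_iff.2 fun i => hinit.aemeasurable_cnnParams i
  have hZm : AEMeasurable (fun ω (i : T) => cnnParams W b i ω) P :=
    aemeasurable_pi_iff.2 fun i => hinit.aemeasurable_cnnParams i
  have hX : IndepFun (fun ω j => h₀ j ω)
      (fun ω => (fun (i : A) => cnnParams W b i ω, fun (i : T) => cnnParams W b i ω)) P :=
    hi.comp (φ := id) (ψ := fun (p : (ℕ × Fin c × Fin c × KernelWindow k) ⊕ (ℕ × Fin c) → ℝ) =>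
      (fun (i : A) => p i, fun (i : T) => p i)) measurable_id
      (by fun_prop)
  have h := indepFun_prodMk_left_of_indepFun hm hYm hZm hX hYZ
  -- Parameters that are not in the past are replaced by zero.
  let ext : (A → ℝ) → ((ℕ × Fin c × Fin c × KernelWindow k) ⊕ (ℕ × Fin c) → ℝ) :=
    fun q p => if hp : p ∈ A then q ⟨p, hp⟩ else 0
  have hext : Measurable ext := by
    refine measurable_pi_lambda _ fun p => ?_
    by_cases hp : p ∈ A
    · simp only [ext, hp, dite_true]; fun_prop
    · simp only [ext, hp, dite_false]; fun_prop
  have hF : Measurable fun q : (Fin c → EuclideanSpace ℝ (ZMod n)) × (A → ℝ) =>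
      preact φ (fun l i j β => ext q.2 (Sum.inl (l, i, j, β)))
        (fun l j => ext q.2 (Sum.inr (l, j))) q.1 l :=
    (continuous_preact (n := n) (k := k) (c := c) hφ l).measurable.comp
      (measurable_fst.prodMk (hext.comp measurable_snd))
  have hG : Measurable fun (q : T → ℝ) (s : LayerIndex k c) =>
      q ⟨layerEmbedding k c l s, by simp [hT]⟩ := by fun_prop
  have h' := h.comp hF hG
  refine IndepFun.congr h' (Eventually.of_forall fun ω => ?_) (Eventually.of_forall fun ω => rfl)
  ext1 j
  simp only [Function.comp_apply, randomPreact]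
  symm
  refine congrFun (preact_congr _ (fun l' hl' => ?_) fun l' hl' => ?_) j
  · ext i j β
    have : (Sum.inl (l', i, j, β) : (ℕ × Fin c × Fin c × KernelWindow k) ⊕ (ℕ × Fin c)) ∈ A := by
      simp [hA, pastIndices, hl']
    simp [ext, this, cnnParams]
  · ext j
    have : (Sum.inr (l', j) : (ℕ × Fin c × Fin c × KernelWindow k) ⊕ (ℕ × Fin c)) ∈ A := by
      simp [hA, pastIndices, hl']
    simp [ext, this, cnnParams]

/-- Each layer is a Gaussian mixture over the preceding one. -/
lemma IsGaussianInit.isGaussianMixture (hinit : IsGaussianInit σw σb P W b)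
    (hφ : Continuous φ) (hm : AEMeasurable (fun ω j => h₀ j ω) P)
    (hi : IndepFun (fun ω j => h₀ j ω) (fun ω p => cnnParams W b p ω) P) (l : ℕ) :
    IsGaussianMixture (P.map fun ω j => randomPreact φ W b h₀ (l + 1) j ω)
      (P.map fun ω j => randomPreact φ W b h₀ l j ω) (condCov k φ σw σb) := by
  have hF : Measurable fun p : (Fin c → EuclideanSpace ℝ (ZMod n)) × (LayerIndex k c → ℝ) =>
      layerMap φ p.1 p.2 := (continuous_layerMap hφ).measurable
  have hpi : ∀ x : Fin c → EuclideanSpace ℝ (ZMod n),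
      ((layerLaw k c σw σb).map fun θ => layerMap φ x θ) =
        Measure.pi fun _ : Fin c => multivariateGaussian 0 (condCov k φ σw σb x) :=
    map_layerMap_layerLaw hφ
  have hl := hinit.aemeasurable_randomPreact hφ hm l
  have hθ : AEMeasurable (fun ω s => cnnParams W b (layerEmbedding k c l s) ω) P :=
    aemeasurable_pi_iff.2 fun s => hinit.aemeasurable_cnnParams _
  refine ⟨posSemidef_condCov, measurable_condCov_entry hφ, ?_, ?_⟩
  · simp_rw [← hpi]
    exact measurable_map_prodMk _ hF
  · simp_rw [← hpi]
    rw [← map_prod_eq_bind _ _ hF, ← hinit.map_layer l,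
      ← (indepFun_iff_map_prod_eq_prod_map_map hl hθ).1 (hinit.indepFun_randomPreact hφ hm hi l),
      AEMeasurable.map_map_of_aemeasurable hF.aemeasurable (hl.prodMk hθ)]
    rfl

end Network

/-! ### Induction on the layers -/

section Limit

lemma ConcentratesAt.mem_of_isClosed {X : ℕ → Type*} [∀ c, MeasurableSpace (X c)] {F : Type*}
    [TopologicalSpace F] {ν : ∀ c, Measure (X c)} [∀ c, IsProbabilityMeasure (ν c)]
    {Y : ∀ c, X c → F} {a : F} (h : ConcentratesAt ν Y a) {s : Set F} (hs : IsClosed s)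
    (hY : ∀ c x, Y c x ∈ s) : a ∈ s := by
  by_contra ha
  have := h sᶜ (hs.isOpen_compl.mem_nhds ha)
  simp only [Set.mem_compl_iff, not_not, hY, Set.ofPred_true, measure_univ] at this
  exact one_ne_zero (tendsto_nhds_unique tendsto_const_nhds this)

lemma isClosed_setOf_posSemidef {ι : Type*} [Fintype ι] :
    IsClosed {S : Matrix ι ι ℝ | S.PosSemidef} := by
  have : {S : Matrix ι ι ℝ | S.PosSemidef} = {S | S.conjTranspose = S} ∩
      ⋂ t : ι → ℝ, {S | 0 ≤ dotProduct (star t) (S.mulVec t)} := by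
    ext S
    simp [Matrix.posSemidef_iff_dotProduct_mulVec, Matrix.IsHermitian]
  rw [this]
  refine (isClosed_eq (by fun_prop) continuous_id).inter (isClosed_iInter fun t => ?_)
  exact isClosed_le continuous_const (by fun_prop)

variable {n k : ℕ} [NeZero n] {φ : ℝ → ℝ} {σw σb : ℝ≥0}

lemma ConcentratesAt.condCov {μ : ∀ c, Measure (Fin c → EuclideanSpace ℝ (ZMod n))}
    {M : Matrix (ZMod n) (ZMod n) ℝ}
    (h : ∀ α α', ConcentratesAt μ
      (fun c y => 1 / (c : ℝ) * ∑ i, φ (y i α) * φ (y i α')) (M α α')) :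
    ConcentratesAt μ (fun c => condCov (c := c) k φ σw σb)
      (diagAverage k (Matrix.of fun α α' => (σw : ℝ) ^ 2 * M α α' + (σb : ℝ) ^ 2)) := by
  have hM : ConcentratesAt μ (fun c y => (Matrix.of fun α α' =>
      1 / (c : ℝ) * ∑ i, φ (y i α) * φ (y i α') : Matrix (ZMod n) (ZMod n) ℝ)) M :=
    ConcentratesAt.pi fun α => ConcentratesAt.pi fun α' => h α α'
  have hc : Continuous fun M : Matrix (ZMod n) (ZMod n) ℝ =>
      diagAverage k (Matrix.of fun α α' => (σw : ℝ) ^ 2 * M α α' + (σb : ℝ) ^ 2) := by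
    refine continuous_matrix fun α α' => ?_
    simp only [diagAverage, Matrix.of_apply]
    fun_prop
  exact hM.comp hc.continuousAt

omit [NeZero n] in
lemma HasBoundedMoments.condCov {μ : ∀ c, Measure (Fin c → EuclideanSpace ℝ (ZMod n))}
    [∀ c, IsProbabilityMeasure (μ c)]
    (h : ∀ α α', HasBoundedMoments μ (fun c y => 1 / (c : ℝ) * ∑ i, φ (y i α) * φ (y i α')))
    (α α' : ZMod n) :
    HasBoundedMoments μ (fun c y => condCov (c := c) k φ σw σb y α α') := by
  simp only [_root_.condCov, diagAverage, Matrix.of_apply]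
  refine HasBoundedMoments.const_mul (HasBoundedMoments.sum _ fun β _ => ?_) _
  exact ((h _ _).const_mul _).add (of_bounded (fun _ => measurable_const) (fun _ _ => le_rfl))

variable {Ω : ℕ → Type*} [∀ c, MeasurableSpace (Ω c)] {P : ∀ c, Measure (Ω c)}
  [∀ c, IsProbabilityMeasure (P c)]
  {W : ∀ c, ℕ → Fin c → Fin c → KernelWindow k → Ω c → ℝ} {b : ∀ c, ℕ → Fin c → Ω c → ℝ}
  {h₀ : ∀ c, Fin c → Ω c → EuclideanSpace ℝ (ZMod n)} {S : ℕ → Matrix (ZMod n) (ZMod n) ℝ}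

/-- The limit theorem for any input that is independent of the parameters and for which the
conditional covariance matrices of the first layer concentrate, and have bounded moments where
convergence of covariances is claimed. Concentration and bounded moments then propagate to the
conditional covariance matrices of all layers, by induction. -/
lemma wide_network_limit (hφ : Continuous φ) (hφ2 : ∀ v : ℝ≥0, MemLp φ 2 (gaussianReal 0 v))
    (hinit : ∀ c, IsGaussianInit σw σb (P c) (W c) (b c))
    (hm : ∀ c, AEMeasurable (fun ω j => h₀ c j ω) (P c))
    (hi : ∀ c, IndepFun (fun ω j => h₀ c j ω) (fun ω p => cnnParams (W c) (b c) p ω) (P c))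
    (hS : ∀ l, S (l + 2) = diagAverage k (cMap φ σw σb (S (l + 1))))
    (h1 : ConcentratesAt (fun c => (P c).map fun ω j => h₀ c j ω)
      (fun c => condCov (c := c) k φ σw σb) (S 1)) :
    (∀ l, ConvergesToIIDGaussian P
      (fun c => randomPreact φ (W c) (b c) (h₀ c) (l + 1)) (S (l + 1))) ∧
    (PolynomiallyBounded φ →
      (∀ α α', HasBoundedMoments (fun c => (P c).map fun ω j => h₀ c j ω)
        (fun c y => condCov (c := c) k φ σw σb y α α')) →
      ∀ l, CovarianceConverges P
        (fun c => randomPreact φ (W c) (b c) (h₀ c) (l + 1)) (S (l + 1))) := by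
  let μ : ℕ → ∀ c, Measure (Fin c → EuclideanSpace ℝ (ZMod n)) := fun l c =>
    (P c).map fun ω j => randomPreact φ (W c) (b c) (h₀ c) l j ω
  have hae : ∀ l c, AEMeasurable (fun ω j => randomPreact φ (W c) (b c) (h₀ c) l j ω) (P c) :=
    fun l c => (hinit c).aemeasurable_randomPreact hφ (hm c) l
  have hμ : ∀ l c, IsProbabilityMeasure (μ l c) := fun l c =>
    Measure.isProbabilityMeasure_map (hae l c)
  have hmix : ∀ l c, IsGaussianMixture (μ (l + 1) c) (μ l c) (condCov k φ σw σb) := fun l c =>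
    (hinit c).isGaussianMixture hφ (hm c) (hi c) l
  have hpsd : ∀ l, ConcentratesAt (μ l) (fun c => condCov (c := c) k φ σw σb) (S (l + 1)) →
      (S (l + 1)).PosSemidef := fun l h =>
    h.mem_of_isClosed isClosed_setOf_posSemidef fun c x => posSemidef_condCov x
  have hconc : ∀ l, ConcentratesAt (μ l) (fun c => condCov (c := c) k φ σw σb) (S (l + 1)) := by
    intro l
    induction l with
    | zero => exact h1
    | succ l ih =>
      rw [hS l]
      exact ConcentratesAt.condCov fun α α' =>
        IsGaussianMixture.concentratesAt_average (hmix l) hφ hφ2 ih (hpsd l ih) α α'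
  refine ⟨fun l => ⟨hpsd l (hconc l), fun m w hw e => ?_⟩, fun hpoly hbdd l => ?_⟩
  · have hme : ∀ r, Measurable fun (y : Fin (w r) → EuclideanSpace ℝ (ZMod n)) (j : Fin m) =>
        y (e r j) := fun r => measurable_pi_lambda _ fun j => measurable_pi_apply _
    refine ⟨fun r => (hme r).comp_aemeasurable (hae (l + 1) (w r)), aemeasurable_id, ?_⟩
    refine ProbabilityMeasure.tendsto_iff_forall_integral_tendsto.2 fun f => ?_
    have h := IsGaussianMixture.tendsto_integral_comp_embedding (hmix l) (hconc l)
      (hpsd l (hconc l)) f.continuous (B := ‖f‖) (fun y => f.norm_coe_le_norm y) hw e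
    simp only [ProbabilityMeasure.coe_mk, Measure.map_id]
    refine h.congr fun r => ?_
    refine (integral_map (f := fun y => f fun j => y (e r j)) (hae (l + 1) (w r))
      (f.continuous.measurable.comp (hme r)).aestronglyMeasurable).trans ?_
    exact (integral_map ((hme r).comp_aemeasurable (hae (l + 1) (w r)))
      f.continuous.aestronglyMeasurable).symm
  · have hb : ∀ l α α', HasBoundedMoments (μ l)
        (fun c y => condCov (c := c) k φ σw σb y α α') := by
      intro l
      induction l with
      | zero => exact hbdd
      | succ l ih =>
        exact HasBoundedMoments.condCov fun α α' =>
          IsGaussianMixture.hasBoundedMoments_average (hmix l) hφ hpoly (fun a => ih a a) α α'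
    have hmul : ∀ c (j : Fin c) α α', ∫ ω, randomPreact φ (W c) (b c) (h₀ c) (l + 1) j ω α *
        randomPreact φ (W c) (b c) (h₀ c) (l + 1) j ω α' ∂(P c) =
        ∫ x, condCov k φ σw σb x α α' ∂(μ l c) := by
      intro c j α α'
      rw [← IsGaussianMixture.integral_eval_mul (hmix l) (fun a => hb l a a) c j α α',
        integral_map (hae (l + 1) c) (Continuous.aestronglyMeasurable (by fun_prop))]
    refine ⟨fun c j α => ⟨?_, ?_⟩, fun α α' ε hε => ?_⟩
    · have := IsGaussianMixture.memLp_eval (hmix l) (hb l α α) c j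
      exact (memLp_map_measure_iff this.aestronglyMeasurable (hae (l + 1) c)).1 this
    · have := IsGaussianMixture.integral_eval (hmix l) (hb l α α) c j
      rwa [integral_map (hae (l + 1) c) (Continuous.aestronglyMeasurable (by fun_prop))] at this
    · obtain ⟨B, hB⟩ := (hb l α α').exists_bound 2 two_ne_zero
      have hent : ConcentratesAt (μ l) (fun c y => condCov (c := c) k φ σw σb y α α')
          (S (l + 1) α α') :=
        (hconc l).comp (g := fun K => K α α') (Continuous.continuousAt (by fun_prop))
      have := hent.tendsto_integral (hb l α α').measurable hB
      filter_upwards [Metric.tendsto_nhds.1 this ε hε] with c hc j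
      rw [hmul]
      exact hc

end Limit

/-! ### The two kinds of input -/

section Input

variable {n k : ℕ} [NeZero n] {φ : ℝ → ℝ} {σw σb : ℝ≥0}

/-- I.i.d. Gaussian vectors as a mixture over a one-point space, which makes the input layer an
instance of the induction step. -/
lemma isGaussianMixture_pi (c : ℕ) {S : Matrix (ZMod n) (ZMod n) ℝ} (hS : S.PosSemidef) :
    IsGaussianMixture (Measure.pi fun _ : Fin c => multivariateGaussian 0 S)
      (Measure.dirac ()) (fun _ => S) := by
  refine ⟨fun _ => hS, fun _ _ => measurable_const, measurable_const, ?_⟩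
  rw [Measure.dirac_bind measurable_const]

lemma IsGaussianInput.map_eq {c : ℕ} {Ω : Type*} [MeasurableSpace Ω] {P : Measure Ω}
    [IsProbabilityMeasure P] {W : ℕ → Fin c → Fin c → KernelWindow k → Ω → ℝ}
    {b : ℕ → Fin c → Ω → ℝ} {S : Matrix (ZMod n) (ZMod n) ℝ}
    {h₀ : Fin c → Ω → EuclideanSpace ℝ (ZMod n)} (h : IsGaussianInput P W b S h₀) :
    (P.map fun ω j => h₀ j ω) = Measure.pi fun _ => multivariateGaussian 0 S := by
  refine ((iIndepFun_iff_map_fun_eq_pi_map fun j => (h.law j).aemeasurable).1 h.indep).trans ?_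
  congr 1
  ext1 j
  exact (h.law j).map_eq

lemma concentratesAt_dirac {E : ℕ → Type*} [∀ c, MeasurableSpace (E c)]
    [∀ c, MeasurableSingletonClass (E c)] {F : Type*} [TopologicalSpace F] {x : ∀ c, E c}
    {Y : ∀ c, E c → F} {a : F} (h : Tendsto (fun c => Y c (x c)) atTop (𝓝 a)) :
    ConcentratesAt (fun c => Measure.dirac (x c)) Y a := by
  intro U hU
  refine tendsto_const_nhds.congr' ?_
  filter_upwards [h hU] with c hc
  have : Y c (x c) ∈ U := hc
  simp [Measure.dirac_apply, this]

lemma hasBoundedMoments_dirac {E : ℕ → Type*} [∀ c, MeasurableSpace (E c)]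
    [∀ c, MeasurableSingletonClass (E c)] {x : ∀ c, E c}
    {Y : ∀ c, E c → ℝ} (hY : ∀ c, Measurable (Y c)) {a : ℝ}
    (h : Tendsto (fun c => Y c (x c)) atTop (𝓝 a)) :
    HasBoundedMoments (fun c => Measure.dirac (x c)) Y := by
  obtain ⟨B, hB⟩ := (Metric.isBounded_range_of_tendsto _ h).exists_norm_le
  refine ⟨hY, fun p _ => ⟨B.toNNReal, fun c => ?_⟩⟩
  refine (eLpNorm_le_of_ae_bound (C := B) ?_).trans ?_
  · rw [ae_dirac_eq]
    exact hB _ ⟨c, rfl⟩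
  · simp [ENNReal.ofReal]

end Input

end

theorem mainTheorem3 {n : ℕ} [NeZero n] (k : ℕ) (σw σb : ℝ≥0) (φ : ℝ → ℝ)
    (hφ : Continuous φ) (hφ2 : ∀ v : ℝ≥0, MemLp φ 2 (gaussianReal 0 v))
    {Ω : ℕ → Type*} [∀ c, MeasurableSpace (Ω c)]
    (P : ∀ c, Measure (Ω c)) [∀ c, IsProbabilityMeasure (P c)]
    (W : ∀ c, ℕ → Fin c → Fin c → KernelWindow k → Ω c → ℝ) (b : ∀ c, ℕ → Fin c → Ω c → ℝ)
    (hinit : ∀ c, IsGaussianInit σw σb (P c) (W c) (b c)) :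
    -- i.i.d. Gaussian input with covariance `S₀`
    (∀ (S₀ : Matrix (ZMod n) (ZMod n) ℝ) (h₀ : ∀ c, Fin c → Ω c → EuclideanSpace ℝ (ZMod n)),
      S₀.PosSemidef → (∀ c, IsGaussianInput (P c) (W c) (b c) S₀ (h₀ c)) →
      ∃ S : ℕ → Matrix (ZMod n) (ZMod n) ℝ,
        S 0 = S₀ ∧
        (∀ l, S (l + 1) = diagAverage k (cMap φ σw σb (S l))) ∧
        (∀ l, ConvergesToIIDGaussian P
          (fun c => randomPreact φ (W c) (b c) (h₀ c) (l + 1)) (S (l + 1))) ∧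
        (PolynomiallyBounded φ → ∀ l, CovarianceConverges P
          (fun c => randomPreact φ (W c) (b c) (h₀ c) (l + 1)) (S (l + 1)))) ∧
    -- deterministic input whose activated empirical second moments converge to `M`
    (∀ (M : Matrix (ZMod n) (ZMod n) ℝ) (h₀ : ∀ c, Fin c → EuclideanSpace ℝ (ZMod n)),
      (∀ α α', Tendsto (fun c : ℕ => (1 / (c : ℝ)) * ∑ i, φ (h₀ c i α) * φ (h₀ c i α')) atTop
        (𝓝 (M α α'))) →
      ∃ S : ℕ → Matrix (ZMod n) (ZMod n) ℝ,
        S 1 = diagAverage k (Matrix.of fun α α' => (σw : ℝ) ^ 2 * M α α' + (σb : ℝ) ^ 2) ∧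
        (∀ l, 1 ≤ l → S (l + 1) = diagAverage k (cMap φ σw σb (S l))) ∧
        (∀ l, ConvergesToIIDGaussian P
          (fun c => randomPreact φ (W c) (b c) (fun i _ => h₀ c i) (l + 1)) (S (l + 1))) ∧
        (PolynomiallyBounded φ → ∀ l, CovarianceConverges P
          (fun c => randomPreact φ (W c) (b c) (fun i _ => h₀ c i) (l + 1)) (S (l + 1)))) := by
  refine ⟨fun S₀ h₀ hS₀ hin => ?_, fun M h₀ hM => ?_⟩
  · let S : ℕ → Matrix (ZMod n) (ZMod n) ℝ :=
      fun l => l.rec S₀ fun _ T => diagAverage k (cMap φ σw σb T)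
    have hmix := fun c => isGaussianMixture_pi (n := n) c hS₀
    have hlaw : (fun c => (P c).map fun ω j => h₀ c j ω) =
        fun c => Measure.pi fun _ : Fin c => multivariateGaussian 0 S₀ :=
      funext fun c => (hin c).map_eq
    have hconc : ConcentratesAt (fun c => (P c).map fun ω j => h₀ c j ω)
        (fun c => condCov (c := c) k φ σw σb) (S 1) := by
      rw [hlaw]
      exact ConcentratesAt.condCov fun α α' =>
        IsGaussianMixture.concentratesAt_average hmix hφ hφ2
          (ConcentratesAt.of_tendsto tendsto_const_nhds) hS₀ α α'
    obtain ⟨hlim, hcov⟩ := wide_network_limit (S := S) hφ hφ2 hinit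
      (fun c => aemeasurable_pi_iff.2 fun j => ((hin c).law j).aemeasurable)
      (fun c => (hin c).indep_params) (fun l => rfl) hconc
    refine ⟨S, rfl, fun l => rfl, hlim, fun hpoly => hcov hpoly ?_⟩
    rw [hlaw]
    exact HasBoundedMoments.condCov fun α α' =>
      IsGaussianMixture.hasBoundedMoments_average hmix hφ hpoly
        (fun a => HasBoundedMoments.of_bounded (fun _ => measurable_const) fun _ _ => le_rfl) α α'
  · -- The covariance matrix at layer `0` plays no role for a deterministic input.
    let S : ℕ → Matrix (ZMod n) (ZMod n) ℝ := fun l => l.casesOn 0 fun l =>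
      l.rec (diagAverage k (Matrix.of fun α α' => (σw : ℝ) ^ 2 * M α α' + (σb : ℝ) ^ 2))
        fun _ T => diagAverage k (cMap φ σw σb T)
    have hlaw : (fun c => (P c).map fun (_ : Ω c) j => h₀ c j) =
        fun c => Measure.dirac (h₀ c) := by
      funext c
      rw [Measure.map_const, measure_univ, one_smul]
    have hconc : ConcentratesAt (fun c => (P c).map fun (_ : Ω c) j => h₀ c j)
        (fun c => condCov (c := c) k φ σw σb) (S 1) := by
      rw [hlaw]
      exact ConcentratesAt.condCov fun α α' => concentratesAt_dirac (hM α α')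
    obtain ⟨hlim, hcov⟩ := wide_network_limit (h₀ := fun c i _ => h₀ c i) (S := S) hφ hφ2 hinit
      (fun c => aemeasurable_const) (fun c => indepFun_const_left _ _) (fun l => rfl) hconc
    refine ⟨S, rfl, fun l hl => ?_, hlim, fun hpoly => hcov hpoly ?_⟩
    · obtain ⟨l, rfl⟩ := Nat.exists_eq_add_of_le' hl
      rfl
    · rw [hlaw]
      exact HasBoundedMoments.condCov fun α α' => hasBoundedMoments_dirac
        (fun c => Continuous.measurable (by fun_prop)) (hM α α')
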